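/- A \emph{tied link diagram} is a diagram $D$ on the sphere $S^2$, taken up to isotopy of $S^2$, of a nonempty unoriented link, together with a partition of the set of link components (the partition defined by the ties); two components in the same class are said to be tied together. Let $\langle\langle\ \rangle\rangle$ be the bracket polynomial of tied links, that is, the function from tied link diagrams to $\mathbb Z[A^{\pm1},c]$ given by the following rules (everything below holds for any function that satisfies them). (i) $\langle\langle O\rangle\rangle=1$ for the circle $O$ without crossings. (ii) $\langle\langle D\sqcup O\rangle\rangle=c\,\langle\langle D\rangle\rangle$ for the disjoint union with a circle without crossings that is not tied to $D$. (iii) $\langle\langle D\,\widetilde\sqcup\,O\rangle\rangle=-(A^2+A^{-2})\langle\langle D\rangle\rangle$ if the added circle is tied to a component of $D$. (iv) $\langle\langle\ \rangle\rangle$ is invariant under the Reidemeister moves II and III. (v) At a crossing of a component with itself or of two components tied together, $\langle\langle D\rangle\rangle=A\,\langle\langle D_A\rangle\rangle+A^{-1}\langle\langle D_B\rangle\rangle$. Here $D_A$ is the smoothing that merges the two corners swept out by turning the overcrossing strand counterclockwise, $D_B$ is the other smoothing, and in both of them the two resulting strands are tied together. (vi) At any crossing, if $D'$ denotes the diagram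 with this crossing changed, $\langle\langle D\rangle\rangle+\langle\langle D'\rangle\rangle=(A+A^{-1})\bigl(\langle\langle D_A\rangle\rangle+\langle\langle D_B\rangle\rangle\bigr)$. Then the following hold. 1. If $K$ is obtained from a tied link diagram $D$ by inserting into an arc a curl (a loop with one crossing that bounds an empty disc), then $\langle\langle K\rangle\rangle=-A^{3}\langle\langle D\rangle\rangle$ if the crossing of the curl is positive (for either orientation of its strand), and $\langle\langle K\rangle\rangle=-A^{-3}\langle\langle D\rangle\rangle$ if it is negative. 2. If $L$ is a classical link diagram, regarded as a tied link diagram whose components are all tied together, then $\langle\langle L\rangle\rangle=\langle L\rangle$, where $$\langle L\rangle=\sum_{s}A^{a(s)-b(s)}\,(-A^2-A^{-2})^{|s|-1}$$ is Kauffman's bracket; $s$ runs through the choices of one of the two smoothings at each crossing, $a(s)$ and $b(s)$ are the numbers of smoothings of the kind $D_A$ and $D_B$, and $|s|$ is the number of closed curves obtained. In particular $\langle\langle L\rangle\rangle=\langle L\rangle$ if $L$ is a diagram of a classical knot (without ties). -/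

import Mathlib

open Equiv Polynomial

/-! ## Link diagrams and tied link diagrams on the sphere

A diagram on the oriented sphere is recorded by its darts (half-edges).  Its vertices are the
crossings (four darts) together with some marked points on the arcs (two darts), at least one on
each closed curve without crossings; so every closed curve carries darts. -/

namespace TiedLink

/-- The equivalence relation obtained from `s` by identifying the classes of `a` and `b`. -/
def glue {α : Type} (s : Setoid α) (a b : α) : Setoid α :=
  s ⊔ Relation.EqvGen.setoid (fun x y => x = a ∧ y = b)

/-- The equivalence relation on a disjoint union which is `r` on the left summand, `s` on the
right one, and relates no element of the left to an element of the right. -/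
def sumSetoid {α β : Type} (r : Setoid α) (s : Setoid β) : Setoid (α ⊕ β) where
  r := Sum.LiftRel r s
  iseqv :=
    { refl := by
        rintro (a | b)
        · exact .inl (r.refl a)
        · exact .inr (s.refl b)
      symm := by
        rintro _ _ (h | h)
        · exact .inl (r.symm h)
        · exact .inr (s.symm h)
      trans := by
        rintro _ _ _ (h | h) (h' | h')
        · exact .inl (r.trans h h')
        · exact .inr (s.trans h h') }

/-- The combinatorial data of a link diagram with set of darts `α`.
* `edge x` is the other half of the edge containing the dart `x`;
* `rot x` is the dart following `x` in the counterclockwise order around the vertex of `x`;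
* `upper` is the set of those darts at crossings that lie on the overcrossing strand;
* `region` : two darts are related when the same region (connected component of the complement
  of the diagram in the sphere) lies on their left, for an observer leaving the vertex along the
  dart; in other words when the corners from `x` to `rot x` and from `y` to `rot y` lie in the
  same region. -/
@[ext] structure LinkData (α : Type) where
  edge : Perm α
  rot : Perm α
  upper : Set α
  region : Setoid α

/-- The data of a link diagram, with the partition of the link components defined by the ties,
recorded as an equivalence relation on the darts. -/
@[ext] structure TiedData (α : Type) extends LinkData α where
  tie : Setoid α

namespace LinkData

variable {α : Type} (D : LinkData α)

/-- The dart `x` sits at a crossing (and not at a marked point of an arc). -/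
def IsCrossing (x : α) : Prop := D.rot (D.rot x) ≠ x

open Classical in
/-- The dart met when one goes straight on through the vertex of `x`. -/
noncomputable def through (x : α) : α :=
  if D.IsCrossing x then D.rot (D.rot x) else D.rot x

/-- The equivalence relation on darts whose classes are the link components. -/
def component : Setoid α :=
  Relation.EqvGen.setoid (fun x y => y = D.edge x ∨ y = D.through x)

/-- The equivalence relation on darts whose classes are the connected components of the
underlying plane graph. -/
def conn : Setoid α :=
  Relation.EqvGen.setoid (fun x y => y = D.edge x ∨ y = D.rot x)

/-- The conditions for the data to come from a nonempty link diagram on the sphere.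
The last three fields are planarity: the region is constant along each boundary walk, the
diagram and its regions together make up a connected surface, and Euler's formula
`V - E + R = 1 + C` for plane graphs with `C` connected components holds. -/
structure IsDiagram : Prop where
  finite : Finite α
  nonempty : Nonempty α
  edge_edge : ∀ x, D.edge (D.edge x) = x
  edge_ne : ∀ x, D.edge x ≠ x
  rot_four : ∀ x, D.rot (D.rot (D.rot (D.rot x))) = x
  rot_ne : ∀ x, D.rot x ≠ x
  upper_rot : ∀ x, D.IsCrossing x → (D.rot x ∈ D.upper ↔ x ∉ D.upper)
  upper_crossing : ∀ x ∈ D.upper, D.IsCrossing x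
  region_face : ∀ x, D.region (D.edge (D.rot x)) x
  region_conn : D.region ⊔ D.conn = ⊤
  euler : Nat.card (Quotient (Perm.SameCycle.setoid D.rot)) + Nat.card (Quotient D.region)
    = Nat.card (Quotient (Perm.SameCycle.setoid D.edge)) + Nat.card (Quotient D.conn) + 1

end LinkData

/-- A link diagram on the sphere. -/
structure LinkDiagram (α : Type) extends LinkData α where
  isDiagram : toLinkData.IsDiagram

/-- A tied link diagram on the sphere. -/
structure TiedDiagram (α : Type) extends TiedData α where
  isDiagram : toLinkData.IsDiagram
  component_le : toLinkData.component ≤ tie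

/-- A link diagram as a tied link diagram without ties. -/
def LinkDiagram.noTies {α : Type} (L : LinkDiagram α) : TiedDiagram α where
  toLinkData := L.toLinkData
  tie := L.component
  isDiagram := L.isDiagram
  component_le := le_rfl

/-- A link diagram as a tied link diagram whose components are all tied together. -/
def LinkDiagram.allTied {α : Type} (L : LinkDiagram α) : TiedDiagram α where
  toLinkData := L.toLinkData
  tie := ⊤
  isDiagram := L.isDiagram
  component_le := le_top

/-! ## Kauffman's bracket -/

namespace LinkData

variable {α : Type} (D : LinkData α)

/-- The crossings of a diagram: the vertices with four darts. -/
def Crossing : Type :=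
  {v : Quotient (Perm.SameCycle.setoid D.rot) // ∃ x, Quotient.mk _ x = v ∧ D.IsCrossing x}

open Classical in
/-- The dart to which `x` is joined at its vertex after all crossings have been smoothed
according to the state `s` (`true` for the `A`-smoothing, `false` for the `B`-smoothing).
The `A`-regions at a crossing are those swept out by turning the overcrossing strand
counterclockwise, that is the corners from `x` to `rot x` with `x` over; the `A`-smoothing
merges them, so it joins an over dart `x` to `rot⁻¹ x` and an under dart `x` to `rot x`. -/
noncomputable def statePartner (s : D.Crossing → Bool) (x : α) : α :=
  if h : D.IsCrossing x then
    if (x ∈ D.upper ↔ s ⟨Quotient.mk _ x, x, rfl, h⟩ = true) then D.rot.symm x else D.rot x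
  else D.rot x

/-- The number of closed curves of the state `s`. -/
noncomputable def loops (s : D.Crossing → Bool) : ℕ :=
  Nat.card (Quotient (Relation.EqvGen.setoid
    (fun x y => y = D.edge x ∨ y = D.statePartner s x)))

end LinkData

/-- The value `-A² - A⁻²` of an additional circle. -/
noncomputable def delta : LaurentPolynomial ℤ :=
  -(LaurentPolynomial.T 2 + LaurentPolynomial.T (-2))

/-- Kauffman's bracket polynomial: the sum over all states `s` of
`A ^ (#A-smoothings - #B-smoothings) * (-A² - A⁻²) ^ (#loops - 1)`. -/
noncomputable def LinkDiagram.kauffmanBracket {α : Type} (L : LinkDiagram α) :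
    LaurentPolynomial ℤ :=
  ∑ᶠ s : L.Crossing → Bool,
    LaurentPolynomial.T
        ((Nat.card {v // s v = true} : ℤ) - (Nat.card {v // s v = false} : ℤ)) *
      delta ^ (L.loops s - 1)

/-! ## Local modifications of tied diagrams -/

/-- The circle without crossings. -/
def circleData : TiedData Bool where
  edge := boolNot
  rot := boolNot
  upper := ∅
  region := ⊥
  tie := ⊤

namespace TiedData

variable {α : Type} (D : TiedData α)

open Classical in
/-- The smoothing, with a tie between the two resulting strands, of the crossing at the dart `u`
that merges the corner from `u` to `rot u` with the opposite corner: `rot u` gets joined to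
`rot² u`, and `rot³ u` to `u`.  It is the `A`-smoothing if `u` is over and the `B`-smoothing if
`u` is under. -/
noncomputable def smooth (u : α) : TiedData α where
  edge := D.edge
  rot := D.rot * swap u (D.rot (D.rot u))
  upper := {x ∈ D.upper | ¬ D.rot.SameCycle u x}
  region := glue D.region u (D.rot (D.rot u))
  tie := glue D.tie u (D.rot u)

/-- The crossing at the dart `u` is changed. -/
def flip (u : α) : TiedData α where
  edge := D.edge
  rot := D.rot
  upper := {x | (D.rot.SameCycle u x ∧ x ∉ D.upper) ∨ (¬ D.rot.SameCycle u x ∧ x ∈ D.upper)}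
  region := D.region
  tie := D.tie

/-- The disjoint union with a circle without crossings, which bounds an empty disc in the region
on the left of the dart `p`. -/
def addCircle (p : α) : TiedData (α ⊕ Bool) where
  edge := sumCongr D.edge boolNot
  rot := sumCongr D.rot boolNot
  upper := Sum.inl '' D.upper
  region := glue (sumSetoid D.region ⊥) (Sum.inl p) (Sum.inr true)
  tie := sumSetoid D.tie ⊤

/-- The same, with a tie between the circle and the component of the dart `t`. -/
def addTiedCircle (p t : α) : TiedData (α ⊕ Bool) where
  toLinkData := (D.addCircle p).toLinkData
  tie := glue (D.addCircle p).tie (Sum.inl t) (Sum.inr true)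

open Classical in
/-- A further point is marked on the edge of the dart `p`: the edge with ends `p` and
`q = edge p` is replaced by an edge from `p` to `inr false` and one from `inr true` to `q`. -/
noncomputable def mark (p : α) : TiedData (α ⊕ Bool) where
  edge := swap (Sum.inl (D.edge p)) (Sum.inr false) * sumCongr D.edge boolNot *
    swap (Sum.inl (D.edge p)) (Sum.inr false)
  rot := sumCongr D.rot boolNot
  upper := Sum.inl '' D.upper
  region := D.region.comap (Sum.elim id (fun b => cond b p (D.edge p)))
  tie := D.tie.comap (Sum.elim id (fun b => cond b p (D.edge p)))

open Classical in
/-- A curl is inserted at the point with darts `p` and `q = rot p` marked on an arc, on the side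
of the corner from `q` to `p`.  The new crossing has the darts `p, q, x, y` in counterclockwise
order, where `x = inr false` and `y = inr true` are the two ends of the loop.  The loop bounds an
empty disc.  If `pos` is true, `q` and `y` are over, so that the two corners other than that of
the loop and its opposite are the `A`-regions (this is the curl whose crossing is positive for
each of the two orientations of its strand); otherwise `p` and `x` are over. -/
noncomputable def curl (pos : Bool) (p : α) : TiedData (α ⊕ Bool) where
  edge := sumCongr D.edge boolNot
  rot := sumCongr D.rot boolNot * swap (Sum.inl (D.rot p)) (Sum.inr true)
  upper := Sum.inl '' D.upper ∪
    cond pos {Sum.inl (D.rot p), Sum.inr true} {Sum.inl p, Sum.inr false}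
  region := glue (sumSetoid D.region ⊥) (Sum.inl (D.rot p)) (Sum.inr true)
  tie := D.tie.comap (Sum.elim id (fun _ => p))

/-- The darts `u` and `v`, at different crossings, are the two corners of a region which is a
bigon, one side of which is over at both crossings. -/
structure IsBigon (u v : α) : Prop where
  crossing_left : D.IsCrossing u
  crossing_right : D.IsCrossing v
  vertices_ne : ¬ D.rot.SameCycle u v
  edge_left : D.edge u = D.rot v
  edge_right : D.edge v = D.rot u
  region_iff : ∀ x, D.region u x ↔ x = u ∨ x = v
  upper_iff : u ∈ D.upper ↔ v ∉ D.upper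

open Classical in
/-- The second Reidemeister move, removing the two crossings of a bigon with corners `u` and `v`.
The vertices are resolved into marked points, so that the two strands get disjoint; the bigon
and the regions opposite to it at the crossings become one region between the strands.
The two sides of the bigon exchange the strands they belong to. -/
noncomputable def removeBigon (u v : α) : TiedData α where
  edge := D.edge
  rot := D.rot * swap u (D.rot (D.rot u)) * swap v (D.rot (D.rot v))
  upper := {x ∈ D.upper | ¬ D.rot.SameCycle u x ∧ ¬ D.rot.SameCycle v x}
  region := glue (glue D.region u (D.rot (D.rot u))) v (D.rot (D.rot v))
  tie := D.tie.comap (swap u (D.rot u) * swap v (D.rot v))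

/-- The darts `t₁, t₂, t₃`, at three different crossings, are the corners of a region which is
a triangle, and one of its three sides is over at both ends (equivalently, the over-under
relation of the three strands is not cyclic). -/
structure IsTriangle (t₁ t₂ t₃ : α) : Prop where
  crossing₁ : D.IsCrossing t₁
  crossing₂ : D.IsCrossing t₂
  crossing₃ : D.IsCrossing t₃
  vertices₁₂ : ¬ D.rot.SameCycle t₁ t₂
  vertices₂₃ : ¬ D.rot.SameCycle t₂ t₃
  vertices₃₁ : ¬ D.rot.SameCycle t₃ t₁
  edge₁ : D.edge t₁ = D.rot t₂
  edge₂ : D.edge t₂ = D.rot t₃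
  edge₃ : D.edge t₃ = D.rot t₁
  region_iff : ∀ x, D.region t₁ x ↔ x = t₁ ∨ x = t₂ ∨ x = t₃
  not_all_over : ¬ (t₁ ∈ D.upper ∧ t₂ ∈ D.upper ∧ t₃ ∈ D.upper)
  not_all_under : ¬ (t₁ ∉ D.upper ∧ t₂ ∉ D.upper ∧ t₃ ∉ D.upper)

open Classical in
/-- The exchange, along each of the three strands through a triangle, of the darts at the first
crossing with the darts of the same direction at the second crossing. -/
noncomputable def trianglePerm (t₁ t₂ t₃ : α) : Perm α :=
  swap (D.rot (D.rot t₁)) (D.rot t₂) * swap t₁ (D.rot (D.rot (D.rot t₂))) *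
    (swap (D.rot (D.rot t₂)) (D.rot t₃) * swap t₂ (D.rot (D.rot (D.rot t₃)))) *
    (swap (D.rot (D.rot t₃)) (D.rot t₁) * swap t₃ (D.rot (D.rot (D.rot t₁))))

/-- The third Reidemeister move: `D'` is obtained from `D` by moving each of the three strands of
the triangle with corners `t₁, t₂, t₃` across the crossing of the other two, so that each strand
meets the other two in the opposite order.  All edges keep their names; the darts that are not
sides of the triangle keep the region on their left, and the new triangle is a region, with
corners `rot t₁, rot t₂, rot t₃`. -/
structure IsTriangleMove (t₁ t₂ t₃ : α) (D' : TiedData α) : Prop where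
  isTriangle : D.IsTriangle t₁ t₂ t₃
  edge_eq : D'.edge = D.edge
  rot_eq : D'.rot = D.trianglePerm t₁ t₂ t₃ * D.rot * (D.trianglePerm t₁ t₂ t₃)⁻¹
  upper_eq : D'.upper = D.trianglePerm t₁ t₂ t₃ '' D.upper
  region_outer : ∀ x y,
    x ∉ ({t₁, t₂, t₃, D.rot t₁, D.rot t₂, D.rot t₃} : Set α) →
    y ∉ ({t₁, t₂, t₃, D.rot t₁, D.rot t₂, D.rot t₃} : Set α) →
    (D'.region x y ↔ D.region x y)
  region_inner : ∀ x, D'.region (D.rot t₁) x ↔ x = D.rot t₁ ∨ x = D.rot t₂ ∨ x = D.rot t₃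
  tie_eq : D'.tie = D.tie

/-- The bijection `φ` of darts is an isomorphism of diagrams, that is, it comes from an
orientation preserving homeomorphism of the sphere. -/
structure IsIso {β : Type} (φ : α ≃ β) (D : TiedData α) (D' : TiedData β) : Prop where
  edge : ∀ x, D'.edge (φ x) = φ (D.edge x)
  rot : ∀ x, D'.rot (φ x) = φ (D.rot x)
  upper : ∀ x, φ x ∈ D'.upper ↔ x ∈ D.upper
  region : ∀ x y, D'.region (φ x) (φ y) ↔ D.region x y
  tie : ∀ x y, D'.tie (φ x) (φ y) ↔ D.tie x y

end TiedData

/-! ## The bracket polynomial of tied links -/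

/-- The variable `A` of `ℤ[A, A⁻¹][c]`; the variable `c` is the polynomial variable `X`. -/
noncomputable def varA : (LaurentPolynomial ℤ)[X] := C (LaurentPolynomial.T 1)

/-- The inverse of the variable `A`. -/
noncomputable def varAInv : (LaurentPolynomial ℤ)[X] := C (LaurentPolynomial.T (-1))

/-- The defining rules of the bracket polynomial of unoriented tied link diagrams. -/
structure IsTiedBracket (f : ∀ α : Type, TiedDiagram α → (LaurentPolynomial ℤ)[X]) : Prop where
  /-- The value only depends on the diagram up to isotopy of the sphere. -/
  iso : ∀ (α β : Type) (φ : α ≃ β) (D : TiedDiagram α) (D' : TiedDiagram β),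
    TiedData.IsIso φ D.toTiedData D'.toTiedData → f β D' = f α D
  /-- The value does not depend on the points marked on the arcs. -/
  mark : ∀ (α : Type) (D : TiedDiagram α) (D' : TiedDiagram (α ⊕ Bool)) (p : α),
    D'.toTiedData = D.mark p → f _ D' = f α D
  circle : ∀ D : TiedDiagram Bool, D.toTiedData = circleData → f Bool D = 1
  addCircle : ∀ (α : Type) (D : TiedDiagram α) (D' : TiedDiagram (α ⊕ Bool)) (p : α),
    D'.toTiedData = D.addCircle p → f _ D' = X * f α D
  addTiedCircle : ∀ (α : Type) (D : TiedDiagram α) (D' : TiedDiagram (α ⊕ Bool)) (p t : α),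
    D'.toTiedData = D.addTiedCircle p t → f _ D' = -(varA ^ 2 + varAInv ^ 2) * f α D
  reidemeister_two : ∀ (α : Type) (D D' : TiedDiagram α) (u v : α),
    D.IsBigon u v → D'.toTiedData = D.removeBigon u v → f α D' = f α D
  reidemeister_three : ∀ (α : Type) (D D' : TiedDiagram α) (t₁ t₂ t₃ : α),
    D.IsTriangleMove t₁ t₂ t₃ D'.toTiedData → f α D' = f α D
  /-- The skein rule at a crossing of a component with itself or with a component tied to it. -/
  skein_tied : ∀ (α : Type) (D D₁ D₂ : TiedDiagram α) (u : α),
    D.IsCrossing u → u ∈ D.upper → D.tie u (D.rot u) →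
    D₁.toTiedData = D.smooth u → D₂.toTiedData = D.smooth (D.rot u) →
    f α D = varA * f α D₁ + varAInv * f α D₂
  /-- The skein rule at an arbitrary crossing. -/
  skein : ∀ (α : Type) (D D' D₁ D₂ : TiedDiagram α) (u : α),
    D.IsCrossing u → D'.toTiedData = D.flip u →
    D₁.toTiedData = D.smooth u → D₂.toTiedData = D.smooth (D.rot u) →
    f α D + f α D' = (varA + varAInv) * (f α D₁ + f α D₂)

end TiedLink

namespace TiedLink

/-! ## Counting equivalence classes -/

section Setoid

variable {α β : Type}

/-! The crossing of a curl is a crossing of a component with itself, so the tied skein rule applies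
to it. One smoothing splits off a circle tied to the arc, with factor `-(A² + A⁻²)`; the other gives
back the arc with a further marked point, with factor `1` (`curl_smooth_left`, `curl_smooth_right`).
For a positive curl the first is the `A`-smoothing, and `-A (A² + A⁻²) + A⁻¹ = -A³`; for a negative
curl the roles are exchanged (`IsTiedBracket.curl`).

If all components are tied together, the tied skein rule applies at every crossing, and both
smoothings are again completely tied, with fewer crossings. Sorting the states by their value at one
crossing gives the same recursion for Kauffman's bracket (`LinkDiagram.kauffmanBracket_smooth`). By
induction (`IsTiedBracket.allTied`) it remains to treat diagrams without crossings, where both sides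
are `delta` to the number of circles minus one (`IsTiedBracket.eq_delta_pow`). There, surplus marked
points are removed; Euler's formula then provides a circle bounding an empty disc, which is split
off. A knot is the case in which being completely tied imposes no tie.

The bracket is defined only on planar diagrams, so each smoothing must be shown to be one
(`smooth_isDiagram`). This rests on one half of Euler's formula, valid for arbitrary such data
(`euler_inequality`). It combines the nonnegativity of the genus of a pair of permutations
(`genus_inequality`) with the semimodularity of the partition lattice (`card_quotient_add_le`). -/

theorem le_glue (s : Setoid α) (a b : α) : s ≤ glue s a b := le_sup_left

theorem glue_self_rel (s : Setoid α) (a b : α) : glue s a b a b :=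
  (le_sup_right : _ ≤ glue s a b) (Relation.EqvGen.rel _ _ ⟨rfl, rfl⟩)

theorem eqvGen_le {r : α → α → Prop} {t : Setoid α} (h : ∀ x y, r x y → t x y) :
    Relation.EqvGen.setoid r ≤ t := by
  intro x y hxy
  induction hxy with
  | rel x y h' => exact h x y h'
  | refl x => exact t.refl x
  | symm x y _ ih => exact t.symm ih
  | trans x y z _ _ ih₁ ih₂ => exact t.trans ih₁ ih₂

theorem glue_le_iff {s t : Setoid α} {a b : α} : glue s a b ≤ t ↔ s ≤ t ∧ t a b := by
  constructor
  · intro h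
    exact ⟨(le_glue s a b).trans h, h (glue_self_rel s a b)⟩
  · rintro ⟨h₁, h₂⟩
    refine sup_le h₁ (eqvGen_le ?_)
    rintro x y ⟨rfl, rfl⟩
    exact h₂

theorem glue_eq_self {s : Setoid α} {a b : α} (h : s a b) : glue s a b = s :=
  le_antisymm (glue_le_iff.2 ⟨le_rfl, h⟩) (le_glue s a b)

theorem glue_comm (s : Setoid α) (a b : α) : glue s a b = glue s b a :=
  le_antisymm
    (glue_le_iff.2 ⟨le_glue s b a, Setoid.symm' _ (glue_self_rel s b a)⟩)
    (glue_le_iff.2 ⟨le_glue s a b, Setoid.symm' _ (glue_self_rel s a b)⟩)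

/-- Two passages between the classes of `a` and `b` in a chain can be shortened to none or one, so
the right-hand side is already transitive. -/
theorem glue_rel_iff {s : Setoid α} {a b x y : α} :
    glue s a b x y ↔ s x y ∨ (s x a ∧ s b y) ∨ (s x b ∧ s a y) := by
  constructor
  · let t : Setoid α :=
      { r := fun x y => s x y ∨ (s x a ∧ s b y) ∨ (s x b ∧ s a y)
        iseqv :=
          { refl := fun x => .inl (s.refl x)
            symm := by
              rintro x y (h | ⟨h, h'⟩ | ⟨h, h'⟩)
              · exact .inl (s.symm h)
              · exact .inr (.inr ⟨s.symm h', s.symm h⟩)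
              · exact .inr (.inl ⟨s.symm h', s.symm h⟩)
            trans := by
              rintro x y z (h | ⟨h, h'⟩ | ⟨h, h'⟩) (k | ⟨k, k'⟩ | ⟨k, k'⟩)
              · exact .inl (s.trans h k)
              · exact .inr (.inl ⟨s.trans h k, k'⟩)
              · exact .inr (.inr ⟨s.trans h k, k'⟩)
              · exact .inr (.inl ⟨h, s.trans h' k⟩)
              · exact .inr (.inl ⟨h, k'⟩)
              · exact .inl (s.trans h k')
              · exact .inr (.inr ⟨h, s.trans h' k⟩)
              · exact .inl (s.trans h k')
              · exact .inr (.inr ⟨h, k'⟩) } }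
    have : glue s a b ≤ t :=
      glue_le_iff.2 ⟨fun x y h => .inl h, .inr (.inl ⟨s.refl a, s.refl b⟩)⟩
    exact fun h => this h
  · have hab := glue_self_rel s a b
    rintro (h | ⟨h, h'⟩ | ⟨h, h'⟩)
    · exact le_glue s a b h
    · exact Setoid.trans' _ (le_glue s a b h) (Setoid.trans' _ hab (le_glue s a b h'))
    · exact Setoid.trans' _ (le_glue s a b h)
        (Setoid.trans' _ (Setoid.symm' _ hab) (le_glue s a b h'))

/-- The classes of `s` other than that of `a` correspond bijectively to the glued classes; the
merged class is represented by `b`. -/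
theorem card_quotient_glue [Finite α] {s : Setoid α} {a b : α} (h : ¬ s a b) :
    Nat.card (Quotient (glue s a b)) + 1 = Nat.card (Quotient s) := by
  classical
  have := Fintype.ofFinite (Quotient s)
  let g : {c : Quotient s // c ≠ Quotient.mk s a} → Quotient (glue s a b) := fun c =>
    Quotient.map' (s₁ := s) (s₂ := glue s a b) id (fun _ _ h => le_glue s a b h) c.1
  have hg : Function.Bijective g := by
    constructor
    · rintro ⟨c, hc⟩ ⟨d, hd⟩ hcd
      induction c using Quotient.inductionOn with | h x => ?_
      induction d using Quotient.inductionOn with | h y => ?_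
      have hx : ¬ s x a := fun h => hc (Quotient.sound h)
      have hy : ¬ s y a := fun h => hd (Quotient.sound h)
      have hxy : glue s a b x y := Quotient.exact hcd
      rcases glue_rel_iff.1 hxy with h | ⟨h, h'⟩ | ⟨h, h'⟩
      · exact Subtype.ext (Quotient.sound h)
      · exact (hx h).elim
      · exact (hy (s.symm h')).elim
    · intro c
      induction c using Quotient.inductionOn with | h x => ?_
      by_cases hx : s x a
      · refine ⟨⟨Quotient.mk s b, fun hb => h (s.symm (Quotient.exact hb))⟩, Quotient.sound ?_⟩
        exact glue_rel_iff.2 (.inr (.inr ⟨s.refl b, s.symm hx⟩))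
      · exact ⟨⟨Quotient.mk s x, fun hb => hx (Quotient.exact hb)⟩, rfl⟩
  rw [← Nat.card_congr (Equiv.ofBijective g hg), Nat.card_eq_fintype_card,
    Nat.card_eq_fintype_card, Fintype.card_subtype_compl, Fintype.card_subtype_eq]
  have : 0 < Fintype.card (Quotient s) := Fintype.card_pos_iff.2 ⟨Quotient.mk s a⟩
  omega

theorem card_quotient_le_glue [Finite α] (s : Setoid α) (a b : α) :
    Nat.card (Quotient s) ≤ Nat.card (Quotient (glue s a b)) + 1 := by
  by_cases h : s a b
  · rw [glue_eq_self h]; omega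
  · rw [card_quotient_glue h]

theorem card_quotient_anti [Finite α] {s t : Setoid α} (h : s ≤ t) :
    Nat.card (Quotient t) ≤ Nat.card (Quotient s) :=
  Nat.card_le_card_of_surjective
    (Quotient.map' (s₁ := s) (s₂ := t) id (fun _ _ h' => h h'))
    (fun c => by
      induction c using Quotient.inductionOn with | h x => ?_
      exact ⟨Quotient.mk s x, rfl⟩)

/-- The rank function of the lattice of partitions is semimodular. -/
theorem card_quotient_add_le [Finite α] {t r s : Setoid α} (hr : t ≤ r) (hs : t ≤ s) :
    Nat.card (Quotient r) + Nat.card (Quotient s) ≤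
      Nat.card (Quotient t) + Nat.card (Quotient (r ⊔ s)) := by
  induction hn : Nat.card (Quotient t) using Nat.strong_induction_on generalizing t s with
  | _ n ih =>
    by_cases hrt : r ≤ t
    · have : r = t := le_antisymm hrt hr
      subst this
      rw [sup_eq_right.2 hs]
      omega
    -- Gluing a pair of `r` that is not in `t` lowers the number of classes of `t` by exactly one,
    -- that of `s` by at most one, and leaves `r ⊔ s` unchanged. So the inequality for the glued
    -- relations implies the one for `t` and `s`.
    · obtain ⟨a, b, hab, hab'⟩ : ∃ a b, r a b ∧ ¬ t a b := by
        by_contra! hcon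
        exact hrt fun a b h => hcon a b h
      have h₁ := card_quotient_glue hab'
      have h₂ := card_quotient_le_glue s a b
      have h₃ : glue t a b ≤ r := glue_le_iff.2 ⟨hr, hab⟩
      have h₄ : glue t a b ≤ glue s a b :=
        glue_le_iff.2 ⟨hs.trans (le_glue s a b), glue_self_rel s a b⟩
      have h₅ := ih (Nat.card (Quotient (glue t a b))) (by omega) h₃ h₄ rfl
      have h₆ : r ⊔ glue s a b = r ⊔ s := by
        refine le_antisymm (sup_le le_sup_left (glue_le_iff.2 ⟨le_sup_right, ?_⟩))
          (sup_le_sup_left (le_glue s a b) r)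
        exact (le_sup_left : r ≤ r ⊔ s) hab
      rw [h₆] at h₅
      omega

/-- Only the classes have to be met by `ρ`, which need be neither injective nor surjective. Hence
regions and components can be counted after darts have been removed. -/
theorem card_quotient_comap {s : Setoid β} (ρ : α → β) (h : ∀ y, ∃ x, s (ρ x) y) :
    Nat.card (Quotient (s.comap ρ)) = Nat.card (Quotient s) := by
  refine Nat.card_congr (Equiv.ofBijective
    (Quotient.map' (s₁ := s.comap ρ) (s₂ := s) ρ (fun _ _ h => h)) ⟨?_, ?_⟩)
  · intro c d hcd
    induction c using Quotient.inductionOn with | h x => ?_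
    induction d using Quotient.inductionOn with | h y => ?_
    exact Quotient.sound (Quotient.exact hcd : s (ρ x) (ρ y))
  · intro c
    induction c using Quotient.inductionOn with | h y => ?_
    obtain ⟨x, hx⟩ := h y
    exact ⟨Quotient.mk _ x, Quotient.sound hx⟩

theorem card_quotient_sumSetoid [Finite α] [Finite β] (r : Setoid α) (s : Setoid β) :
    Nat.card (Quotient (sumSetoid r s)) = Nat.card (Quotient r) + Nat.card (Quotient s) := by
  rw [← Nat.card_sum]
  refine Nat.card_congr
    { toFun := Quotient.lift
        (Sum.elim (fun a => Sum.inl (Quotient.mk r a)) (fun b => Sum.inr (Quotient.mk s b))) ?_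
      invFun := Sum.elim
        (Quotient.lift (fun a => Quotient.mk _ (Sum.inl a))
          fun a b h => Quotient.sound (Sum.LiftRel.inl h))
        (Quotient.lift (fun a => Quotient.mk _ (Sum.inr a))
          fun a b h => Quotient.sound (Sum.LiftRel.inr h))
      left_inv := ?_
      right_inv := ?_ }
  · rintro _ _ (h | h)
    · exact congrArg Sum.inl (Quotient.sound h)
    · exact congrArg Sum.inr (Quotient.sound h)
  · intro c
    induction c using Quotient.inductionOn with | h x => ?_
    rcases x with x | x <;> rfl
  · rintro (c | c) <;> induction c using Quotient.inductionOn <;> rfl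

theorem card_quotient_bot : Nat.card (Quotient (⊥ : Setoid α)) = Nat.card α :=
  Nat.card_congr (Equiv.ofBijective (Quotient.mk ⊥)
    ⟨fun _ _ h => Quotient.exact h, Quotient.mk_surjective⟩).symm

theorem card_quotient_top [Nonempty α] : Nat.card (Quotient (⊤ : Setoid α)) = 1 := by
  have : Subsingleton (Quotient (⊤ : Setoid α)) := Quotient.subsingleton_iff.2 rfl
  have : Nonempty (Quotient (⊤ : Setoid α)) := ‹Nonempty α›.map (Quotient.mk _)
  exact Nat.card_of_subsingleton (Classical.arbitrary _)

theorem card_eq_sum_fibers [Finite α] (s : Setoid α) [Fintype (Quotient s)] :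
    Nat.card α = ∑ q : Quotient s, Nat.card {x // Quotient.mk s x = q} := by
  have := Fintype.ofFinite α
  rw [← Nat.card_sigma]
  exact Nat.card_congr (Equiv.sigmaFiberEquiv (Quotient.mk s)).symm

/-- Every class has at least two elements. Besides counting the cycles of involutions, this yields
an innermost circle by contradiction. -/
theorem two_mul_card_quotient_le [Finite α] {s : Setoid α} (h : ∀ x, ∃ y, y ≠ x ∧ s x y) :
    2 * Nat.card (Quotient s) ≤ Nat.card α := by
  have := Fintype.ofFinite (Quotient s)
  rw [card_eq_sum_fibers s, Nat.card_eq_fintype_card, mul_comm, ← smul_eq_mul, ← Finset.card_univ]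
  refine Finset.card_nsmul_le_sum _ _ _ fun q _ => ?_
  induction q using Quotient.inductionOn with | h x => ?_
  obtain ⟨y, hy, hxy⟩ := h x
  have : Nontrivial {z // Quotient.mk s z = Quotient.mk s x} :=
    ⟨⟨⟨y, Quotient.sound (s.symm hxy)⟩, ⟨x, rfl⟩, fun h => hy (congrArg Subtype.val h)⟩⟩
  exact Finite.one_lt_card

theorem card_le_two_mul_card_quotient [Finite α] {s : Setoid α} (e : α → α)
    (h : ∀ x y, s x y → y = x ∨ y = e x) : Nat.card α ≤ 2 * Nat.card (Quotient s) := by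
  have := Fintype.ofFinite (Quotient s)
  rw [card_eq_sum_fibers s, Nat.card_eq_fintype_card, mul_comm, ← smul_eq_mul, ← Finset.card_univ]
  refine Finset.sum_le_card_nsmul _ _ _ fun q _ => ?_
  induction q using Quotient.inductionOn with | h x => ?_
  have hsub : {z | Quotient.mk s z = Quotient.mk s x} ⊆ {x, e x} :=
    fun z hz => h x z (s.symm (Quotient.exact hz))
  exact (Set.ncard_le_ncard hsub (Set.toFinite _)).trans ((Set.ncard_insert_le _ _).trans (by simp))

end Setoid

/-! ## Cycles of permutations -/

section Cycles

variable {α : Type}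

theorem sameCycle_le {g : Perm α} {s : Setoid α} (h : ∀ x, s x (g x)) :
    Perm.SameCycle.setoid g ≤ s := by
  rintro x y ⟨i, rfl⟩
  have hnat : ∀ (n : ℕ) (x : α), s x ((g ^ n) x) := by
    intro n
    induction n with
    | zero => exact fun x => s.refl x
    | succ n ih =>
      intro x
      rw [pow_succ', Perm.mul_apply]
      exact s.trans (ih x) (h _)
  rcases i with n | n
  · exact hnat n x
  -- For a negative exponent, `n + 1` forward steps lead from the other end back to `x`.
  · have := hnat (n + 1) ((g ^ (Int.negSucc n)) x)
    rw [← zpow_natCast, ← Perm.mul_apply, ← zpow_add] at this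
    rw [show ((n + 1 : ℕ) : ℤ) + Int.negSucc n = 0 by omega] at this
    exact s.symm this

theorem sameCycle_apply (g : Perm α) (x : α) : Perm.SameCycle.setoid g x (g x) :=
  ⟨1, by simp⟩

/-- The product sends `a` to `g b` and then runs along the `g`-cycle of `b`, which avoids `a`, until
its first return to `b`. -/
theorem sameCycle_mul_swap [Finite α] [DecidableEq α] {g : Perm α} {a b : α}
    (h : ¬ g.SameCycle a b) : (g * swap a b).SameCycle a b := by
  obtain ⟨g', hg'⟩ : ∃ g', g' = g * swap a b := ⟨_, rfl⟩
  rw [← hg']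
  have hab : a ≠ b := fun e => h (e ▸ Perm.SameCycle.refl g a)
  have hex : ∃ n : ℕ, (g ^ (n + 1)) b = b := by
    refine ⟨orderOf g - 1, ?_⟩
    rw [Nat.sub_add_cancel (orderOf_pos g), pow_orderOf_eq_one, Perm.one_apply]
  classical
  have key : ∀ n, n ≤ Nat.find hex → (g' ^ (n + 1)) a = (g ^ (n + 1)) b := by
    intro n
    induction n with
    | zero => intro _; simp [hg']
    | succ n ih =>
      intro hn
      rw [pow_succ', Perm.mul_apply, ih (by omega), pow_succ' g (n + 1), Perm.mul_apply, hg',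
        Perm.mul_apply, swap_apply_of_ne_of_ne]
      · intro e
        exact h (Perm.SameCycle.symm ⟨(n + 1 : ℕ), by rw [zpow_natCast]; exact e⟩)
      · exact Nat.find_min hex (by omega)
  refine ⟨(Nat.find hex + 1 : ℕ), ?_⟩
  rw [zpow_natCast, key _ le_rfl]
  exact Nat.find_spec hex

theorem sameCycle_mul_swap_le [DecidableEq α] (g : Perm α) (a b : α) :
    Perm.SameCycle.setoid (g * swap a b) ≤ glue (Perm.SameCycle.setoid g) a b := by
  refine sameCycle_le fun x => ?_
  have hg : ∀ y, glue (Perm.SameCycle.setoid g) a b y (g y) :=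
    fun y => le_glue _ a b (sameCycle_apply g y)
  rw [Perm.mul_apply]
  rcases eq_or_ne x a with rfl | ha
  · rw [swap_apply_left]
    exact Setoid.trans' _ (glue_self_rel _ _ _) (hg b)
  · rcases eq_or_ne x b with rfl | hb
    · rw [swap_apply_right]
      exact Setoid.trans' _ (Setoid.symm' _ (glue_self_rel _ _ _)) (hg a)
    · rw [swap_apply_of_ne_of_ne ha hb]
      exact hg x

/-- A transposition is its own inverse, so `g` arises from `g * swap a b` in the same way. -/
theorem le_glue_sameCycle_mul_swap [DecidableEq α] (g : Perm α) (a b : α) :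
    Perm.SameCycle.setoid g ≤ glue (Perm.SameCycle.setoid (g * swap a b)) a b := by
  have := sameCycle_mul_swap_le (g * swap a b) a b
  rwa [mul_assoc, swap_mul_self, mul_one] at this

/-- Composition with a transposition of elements of different cycles joins the two cycles. -/
theorem sameCycle_setoid_mul_swap [Finite α] [DecidableEq α] {g : Perm α} {a b : α}
    (h : ¬ g.SameCycle a b) :
    Perm.SameCycle.setoid (g * swap a b) = glue (Perm.SameCycle.setoid g) a b := by
  refine le_antisymm (sameCycle_mul_swap_le g a b) (glue_le_iff.2 ⟨?_, sameCycle_mul_swap h⟩)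
  have := le_glue_sameCycle_mul_swap g a b
  rwa [glue_eq_self (sameCycle_mul_swap h)] at this

theorem card_cycles_mul_swap [Finite α] [DecidableEq α] {g : Perm α} {a b : α}
    (h : ¬ g.SameCycle a b) :
    Nat.card (Quotient (Perm.SameCycle.setoid (g * swap a b))) + 1 =
      Nat.card (Quotient (Perm.SameCycle.setoid g)) := by
  rw [sameCycle_setoid_mul_swap h]
  exact card_quotient_glue h

theorem card_cycles_mul_swap_le [Finite α] [DecidableEq α] (g : Perm α) (a b : α) :
    Nat.card (Quotient (Perm.SameCycle.setoid (g * swap a b))) ≤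
      Nat.card (Quotient (Perm.SameCycle.setoid g)) + 1 :=
  (card_quotient_le_glue _ a b).trans
    (Nat.add_le_add_right (card_quotient_anti (le_glue_sameCycle_mul_swap g a b)) 1)

theorem sameCycle_mul_le (a b : Perm α) :
    Perm.SameCycle.setoid (a * b) ≤ Perm.SameCycle.setoid a ⊔ Perm.SameCycle.setoid b := by
  refine sameCycle_le fun x => Setoid.trans' _ (y := b x) ?_ ?_
  · exact (le_sup_right : _ ≤ Perm.SameCycle.setoid a ⊔ Perm.SameCycle.setoid b)
      (sameCycle_apply b x)
  · exact (le_sup_left : _ ≤ Perm.SameCycle.setoid a ⊔ Perm.SameCycle.setoid b)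
      (sameCycle_apply a (b x))

/-- The genus of a pair of permutations is not negative. -/
theorem genus_inequality [Finite α] (a b : Perm α) :
    Nat.card (Quotient (Perm.SameCycle.setoid a)) + Nat.card (Quotient (Perm.SameCycle.setoid b)) +
        Nat.card (Quotient (Perm.SameCycle.setoid (a * b))) ≤
      Nat.card α +
        2 * Nat.card (Quotient (Perm.SameCycle.setoid a ⊔ Perm.SameCycle.setoid b)) := by
  classical
  have := Fintype.ofFinite α
  induction hn : b.support.card using Nat.strong_induction_on generalizing b with
  | _ n ih =>
    by_cases hb : b = 1
    · subst hb
      have h1 : Perm.SameCycle.setoid (1 : Perm α) = ⊥ :=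
        le_bot_iff.1 (sameCycle_le fun x => rfl)
      rw [mul_one, h1, sup_bot_eq, card_quotient_bot]
      omega
    · obtain ⟨x, hx⟩ : ∃ x, b x ≠ x := by
        by_contra! hcon
        exact hb (Perm.ext hcon)
      obtain ⟨z, hbz⟩ : ∃ z, b z = x := b.surjective x
      have hxz : x ≠ z := fun e => hx (by rw [← e] at hbz; exact hbz)
      -- Splitting the point `x` off its cycle leaves a permutation that fixes `x` and has smaller
      -- support.
      obtain ⟨b', rfl⟩ : ∃ b', b = b' * swap x z :=
        ⟨b * swap x z, by rw [mul_assoc, swap_mul_self, mul_one]⟩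
      have hb'x : b' x = x := by simpa using hbz
      have hsub : b'.support ⊂ (b' * swap x z).support := by
        refine Finset.ssubset_iff_subset_ne.2 ⟨fun y hy => ?_, fun e => ?_⟩
        · rw [Perm.mem_support] at hy ⊢
          have hyx : y ≠ x := fun e => hy (e ▸ hb'x)
          rcases eq_or_ne y z with rfl | hyz
          · rw [hbz]; exact hxz
          · rwa [Perm.mul_apply, swap_apply_of_ne_of_ne hyx hyz]
        · have : x ∈ b'.support := by rw [e]; exact Perm.mem_support.2 hx
          exact Perm.mem_support.1 this hb'x
      have hIH := ih _ (hn ▸ Finset.card_lt_card hsub) b' rfl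
      have hnot : ¬ b'.SameCycle x z := by
        rintro ⟨i, hi⟩
        rw [Perm.zpow_apply_eq_self_of_apply_eq_self hb'x] at hi
        exact hxz hi
      have h₁ := card_cycles_mul_swap hnot
      have hc : Perm.SameCycle.setoid a ⊔ Perm.SameCycle.setoid (b' * swap x z) =
          glue (Perm.SameCycle.setoid a ⊔ Perm.SameCycle.setoid b') x z := by
        rw [sameCycle_setoid_mul_swap hnot, glue, glue, sup_assoc]
      rw [hc, ← mul_assoc]
      -- If `x` and `z` were already connected, `b` loses a cycle, the product gains at most one,
      -- and the orbits stay the same. Otherwise `b`, the product and the set of orbits each lose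
      -- exactly one class, so both sides drop by two.
      by_cases hcon : (Perm.SameCycle.setoid a ⊔ Perm.SameCycle.setoid b') x z
      · rw [glue_eq_self hcon]
        have h₂ := card_cycles_mul_swap_le (a * b') x z
        omega
      · have h₂ := card_quotient_glue hcon
        have h₃ : ¬ (a * b').SameCycle x z := fun h => hcon (sameCycle_mul_le a b' h)
        have h₄ := card_cycles_mul_swap h₃
        omega

theorem sameCycle_involution {e : Perm α} (he : ∀ x, e (e x) = x) {x y : α} :
    e.SameCycle x y ↔ y = x ∨ y = e x := by
  constructor
  · let s : Setoid α :=
      { r := fun x y => y = x ∨ y = e x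
        iseqv :=
          { refl := fun x => .inl rfl
            symm := by rintro x y (rfl | rfl) <;> simp [he]
            trans := by rintro x y z (rfl | rfl) (rfl | rfl) <;> simp [he] } }
    have : Perm.SameCycle.setoid e ≤ s := sameCycle_le fun x => .inr rfl
    exact fun h => this h
  · rintro (rfl | rfl)
    · exact Perm.SameCycle.refl _ _
    · exact sameCycle_apply e x

theorem two_mul_card_cycles_involution [Finite α] {e : Perm α} (he : ∀ x, e (e x) = x)
    (hne : ∀ x, e x ≠ x) : 2 * Nat.card (Quotient (Perm.SameCycle.setoid e)) = Nat.card α :=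
  le_antisymm (two_mul_card_quotient_le fun x => ⟨e x, hne x, sameCycle_apply e x⟩)
    (card_le_two_mul_card_quotient e fun _ _ h => (sameCycle_involution he).1 h)

theorem sameCycle_order_four {g : Perm α} (hg : ∀ x, g (g (g (g x))) = x) {x y : α} :
    g.SameCycle x y ↔ y = x ∨ y = g x ∨ y = g (g x) ∨ y = g (g (g x)) := by
  constructor
  · let s : Setoid α :=
      { r := fun x y => y = x ∨ y = g x ∨ y = g (g x) ∨ y = g (g (g x))
        iseqv :=
          { refl := fun x => .inl rfl
            symm := by rintro x y (rfl | rfl | rfl | rfl) <;> simp [hg]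
            trans := by
              rintro x y z (rfl | rfl | rfl | rfl) (rfl | rfl | rfl | rfl) <;> simp [hg] } }
    have : Perm.SameCycle.setoid g ≤ s := sameCycle_le fun x => .inr (.inl rfl)
    exact fun h => this h
  · rintro (rfl | rfl | rfl | rfl)
    · exact Perm.SameCycle.refl _ _
    · exact ⟨1, rfl⟩
    · exact ⟨2, rfl⟩
    · exact ⟨3, rfl⟩

end Cycles

/-! ## Euler's inequality and smoothings of diagrams -/

namespace LinkData

variable {α : Type} {D : LinkData α}

theorem conn_eq_sup (D : LinkData α) :
    D.conn = Perm.SameCycle.setoid D.edge ⊔ Perm.SameCycle.setoid D.rot := by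
  refine le_antisymm (eqvGen_le ?_) (sup_le (sameCycle_le fun x => ?_) (sameCycle_le fun x => ?_))
  · rintro x y (rfl | rfl)
    · exact (le_sup_left : _ ≤ Perm.SameCycle.setoid D.edge ⊔ _) (sameCycle_apply _ x)
    · exact (le_sup_right : _ ≤ _ ⊔ Perm.SameCycle.setoid D.rot) (sameCycle_apply _ x)
  · exact Relation.EqvGen.rel _ _ (.inl rfl)
  · exact Relation.EqvGen.rel _ _ (.inr rfl)

theorem conn_edge (D : LinkData α) (x : α) : D.conn x (D.edge x) :=
  Relation.EqvGen.rel _ _ (.inl rfl)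

theorem conn_rot (D : LinkData α) (x : α) : D.conn x (D.rot x) :=
  Relation.EqvGen.rel _ _ (.inr rfl)

theorem conn_le {s : Setoid α} (he : ∀ x, s x (D.edge x)) (hr : ∀ x, s x (D.rot x)) :
    D.conn ≤ s := by
  refine eqvGen_le ?_
  rintro x y (rfl | rfl)
  · exact he x
  · exact hr x

/-- Let `F` be the number of cycles of `edge * rot`, the boundary walks. Since there are `2E` darts,
nonnegative genus reads `V + F ≤ E + 2C`. Boundary walks refine both regions and connected
components, whose join is trivial, so semimodularity gives `R + C ≤ F + 1`. Adding the two proves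
the claim. -/
theorem euler_inequality [Finite α] [Nonempty α] (he : ∀ x, D.edge (D.edge x) = x)
    (hne : ∀ x, D.edge x ≠ x) (hface : ∀ x, D.region (D.edge (D.rot x)) x)
    (hconn : D.region ⊔ D.conn = ⊤) :
    Nat.card (Quotient (Perm.SameCycle.setoid D.rot)) + Nat.card (Quotient D.region) ≤
      Nat.card (Quotient (Perm.SameCycle.setoid D.edge)) + Nat.card (Quotient D.conn) + 1 := by
  have h₁ := genus_inequality D.edge D.rot
  rw [← D.conn_eq_sup] at h₁
  have h₂ := two_mul_card_cycles_involution he hne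
  have h₃ : Perm.SameCycle.setoid (D.edge * D.rot) ≤ D.region :=
    sameCycle_le fun x => D.region.symm (hface x)
  have h₄ : Perm.SameCycle.setoid (D.edge * D.rot) ≤ D.conn := by
    rw [D.conn_eq_sup]
    exact sameCycle_mul_le _ _
  have h₅ := card_quotient_add_le h₃ h₄
  rw [hconn, card_quotient_top] at h₅
  omega

theorem isCrossing_rot (x : α) : D.IsCrossing (D.rot x) ↔ D.IsCrossing x := by
  simp [IsCrossing, D.rot.injective.eq_iff]

theorem through_of_isCrossing {x : α} (h : D.IsCrossing x) : D.through x = D.rot (D.rot x) :=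
  if_pos h

theorem through_of_not_isCrossing {x : α} (h : ¬ D.IsCrossing x) : D.through x = D.rot x :=
  if_neg h

theorem component_edge (D : LinkData α) (x : α) : D.component x (D.edge x) :=
  Relation.EqvGen.rel _ _ (.inl rfl)

theorem component_through (D : LinkData α) (x : α) : D.component x (D.through x) :=
  Relation.EqvGen.rel _ _ (.inr rfl)

theorem isCrossing_of_sameCycle {x y : α} (hD : D.IsDiagram) (h : D.rot.SameCycle x y) :
    D.IsCrossing y ↔ D.IsCrossing x := by
  rcases (sameCycle_order_four hD.rot_four).1 h with rfl | rfl | rfl | rfl <;>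
    simp [isCrossing_rot]

theorem exists_upper (hD : D.IsDiagram) {x : α} (hx : D.IsCrossing x) :
    ∃ u, D.IsCrossing u ∧ u ∈ D.upper := by
  by_cases h : x ∈ D.upper
  · exact ⟨x, hx, h⟩
  · exact ⟨D.rot x, (isCrossing_rot x).2 hx, (hD.upper_rot x hx).2 h⟩

end LinkData

/-! ### Planarity of smoothings -/

namespace TiedData

open LinkData

variable {α : Type} {D : TiedData α} {u : α}

theorem smooth_rot_self (D : TiedData α) (u : α) :
    (D.smooth u).rot u = D.rot (D.rot (D.rot u)) := by
  simp [smooth]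

theorem smooth_rot_rot_rot (D : TiedData α) (u : α) :
    (D.smooth u).rot (D.rot (D.rot u)) = D.rot u := by
  simp [smooth]

theorem smooth_rot_of_ne {x : α} (h : x ≠ u) (h' : x ≠ D.rot (D.rot u)) :
    (D.smooth u).rot x = D.rot x := by
  classical
  simp [smooth, swap_apply_of_ne_of_ne h h']

theorem smooth_rot_of_not_sameCycle {x : α} (h : ¬ D.rot.SameCycle u x) :
    (D.smooth u).rot x = D.rot x :=
  smooth_rot_of_ne (fun e => h (e ▸ Perm.SameCycle.refl _ _))
    (fun e => h ⟨2, by rw [e]; rfl⟩)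

theorem smooth_rot_rot (hD : D.IsDiagram) :
    (D.smooth u).rot (D.rot u) = D.rot (D.rot u) :=
  smooth_rot_of_ne (hD.rot_ne u) (fun e => hD.rot_ne u (D.rot.injective e).symm)

theorem smooth_rot_rot_rot_rot (hD : D.IsDiagram) :
    (D.smooth u).rot (D.rot (D.rot (D.rot u))) = u := by
  rw [smooth_rot_of_ne _ (hD.rot_ne _), hD.rot_four]
  intro e
  exact hD.rot_ne u (by simpa [hD.rot_four] using (congrArg D.rot e).symm)

/-- The four-cycle of the crossing breaks up into the two-cycles of `u, rot³ u` and of `rot u, rot²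
u`, that is, into two marked points. -/
theorem smooth_rot_smooth_rot (hD : D.IsDiagram) (hu : D.IsCrossing u) {x : α}
    (h : D.rot.SameCycle u x) : (D.smooth u).rot ((D.smooth u).rot x) = x := by
  rcases (sameCycle_order_four hD.rot_four).1 h with rfl | rfl | rfl | rfl
  · rw [smooth_rot_self, smooth_rot_rot_rot_rot hD]
  · rw [smooth_rot_rot hD, smooth_rot_rot_rot]
  · rw [smooth_rot_rot_rot, smooth_rot_rot hD]
  · rw [smooth_rot_rot_rot_rot hD, smooth_rot_self]

theorem not_sameCycle_rot {x : α} (h : ¬ D.rot.SameCycle u x) : ¬ D.rot.SameCycle u (D.rot x) :=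
  fun h' => h (Perm.sameCycle_apply_right.1 h')

theorem smooth_isCrossing (hD : D.IsDiagram) (hu : D.IsCrossing u) {x : α} :
    (D.smooth u).IsCrossing x ↔ D.IsCrossing x ∧ ¬ D.rot.SameCycle u x := by
  by_cases h : D.rot.SameCycle u x
  · simp [IsCrossing, smooth_rot_smooth_rot hD hu h, h]
  · rw [IsCrossing, smooth_rot_of_not_sameCycle h,
      smooth_rot_of_not_sameCycle (not_sameCycle_rot h)]
    simp [IsCrossing, h]

theorem smooth_rot_four (hD : D.IsDiagram) (hu : D.IsCrossing u) (x : α) :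
    (D.smooth u).rot ((D.smooth u).rot ((D.smooth u).rot ((D.smooth u).rot x))) = x := by
  by_cases h : D.rot.SameCycle u x
  · rw [smooth_rot_smooth_rot hD hu h, smooth_rot_smooth_rot hD hu h]
  · have h₁ := not_sameCycle_rot h
    have h₂ := not_sameCycle_rot h₁
    have h₃ := not_sameCycle_rot h₂
    rw [smooth_rot_of_not_sameCycle h, smooth_rot_of_not_sameCycle h₁,
      smooth_rot_of_not_sameCycle h₂, smooth_rot_of_not_sameCycle h₃, hD.rot_four]

theorem smooth_rot_ne (hD : D.IsDiagram) (hu : D.IsCrossing u) (x : α) :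
    (D.smooth u).rot x ≠ x := by
  by_cases h : D.rot.SameCycle u x
  · rcases (sameCycle_order_four hD.rot_four).1 h with rfl | rfl | rfl | rfl
    · rw [smooth_rot_self]
      intro e
      exact hD.rot_ne x (by simpa [hD.rot_four] using (congrArg D.rot e).symm)
    · rw [smooth_rot_rot hD]; exact hD.rot_ne _
    · rw [smooth_rot_rot_rot]; exact (hD.rot_ne _).symm
    · rw [smooth_rot_rot_rot_rot hD]
      intro e
      exact hD.rot_ne u (by simpa [hD.rot_four] using congrArg D.rot e)
  · rw [smooth_rot_of_not_sameCycle h]; exact hD.rot_ne _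

theorem smooth_not_sameCycle (hD : D.IsDiagram) (hu : D.IsCrossing u) :
    ¬ (D.smooth u).rot.SameCycle u (D.rot (D.rot u)) := by
  intro h
  rcases (sameCycle_order_four (smooth_rot_four hD hu)).1 h with e | e | e | e
  · exact hu e
  · rw [smooth_rot_self] at e
    exact hD.rot_ne _ e.symm
  · rw [smooth_rot_smooth_rot hD hu (Perm.SameCycle.refl _ _)] at e
    exact hu e
  · rw [smooth_rot_smooth_rot hD hu (Perm.SameCycle.refl _ _), smooth_rot_self] at e
    exact hD.rot_ne _ e.symm

/-- Read backwards, smoothing is a transposition joining two different cycles, the situation in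
which cycles can be counted exactly. -/
theorem rot_eq_smooth_mul_swap [DecidableEq α] (D : TiedData α) (u : α) :
    D.rot = (D.smooth u).rot * swap u (D.rot (D.rot u)) := by
  ext x
  rcases eq_or_ne x u with rfl | h₁
  · simp [smooth_rot_rot_rot]
  · rcases eq_or_ne x (D.rot (D.rot u)) with rfl | h₂
    · simp [smooth_rot_self]
    · rw [Perm.mul_apply, swap_apply_of_ne_of_ne h₁ h₂, smooth_rot_of_ne h₁ h₂]

theorem smooth_card_rot (hD : D.IsDiagram) (hu : D.IsCrossing u) :
    Nat.card (Quotient (Perm.SameCycle.setoid D.rot)) + 1 =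
      Nat.card (Quotient (Perm.SameCycle.setoid (D.smooth u).rot)) := by
  classical
  have := hD.finite
  rw [← card_cycles_mul_swap (smooth_not_sameCycle hD hu), ← rot_eq_smooth_mul_swap]

theorem conn_eq_glue_smooth (hD : D.IsDiagram) (hu : D.IsCrossing u) :
    D.conn = glue (D.smooth u).conn u (D.rot (D.rot u)) := by
  classical
  have := hD.finite
  rw [conn_eq_sup, conn_eq_sup, glue, sup_assoc]
  congr 1
  conv_lhs => rw [rot_eq_smooth_mul_swap D u]
  exact sameCycle_setoid_mul_swap (smooth_not_sameCycle hD hu)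

theorem smooth_region_face (hD : D.IsDiagram) (x : α) :
    (D.smooth u).region ((D.smooth u).edge ((D.smooth u).rot x)) x := by
  have hface : ∀ y, glue D.region u (D.rot (D.rot u)) (D.edge (D.rot y)) y :=
    fun y => le_glue _ _ _ (hD.region_face y)
  have hg := glue_self_rel D.region u (D.rot (D.rot u))
  change glue D.region u (D.rot (D.rot u)) (D.edge ((D.smooth u).rot x)) x
  rcases eq_or_ne x u with rfl | h₁
  · rw [smooth_rot_self]
    exact Setoid.trans' _ (hface _) (Setoid.symm' _ hg)
  · rcases eq_or_ne x (D.rot (D.rot u)) with rfl | h₂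
    · rw [smooth_rot_rot_rot]
      exact Setoid.trans' _ (hface _) hg
    · rw [smooth_rot_of_ne h₁ h₂]
      exact hface x

/-- The only connection lost by the smoothing is between `u` and `rot² u`, and exactly these are
identified in the new region relation. -/
theorem smooth_region_conn (hD : D.IsDiagram) (hu : D.IsCrossing u) :
    (D.smooth u).region ⊔ (D.smooth u).conn = ⊤ := by
  rw [eq_top_iff, ← hD.region_conn, conn_eq_glue_smooth hD hu]
  refine sup_le (le_sup_of_le_left (le_glue _ _ _)) (glue_le_iff.2 ⟨le_sup_right, ?_⟩)
  exact (le_sup_left : (D.smooth u).region ≤ _) (glue_self_rel _ _ _)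

/-- If a smoothing disconnects the diagram, the corners it merges belong to the same region. -/
theorem region_of_not_smooth_conn (hD : D.IsDiagram)
    (h : ¬ (D.smooth u).conn u (D.rot (D.rot u))) : D.region u (D.rot (D.rot u)) := by
  classical
  have := hD.finite
  -- Boundary walks stay within connected components. So the two corners lie on different boundary
  -- walks of the smoothing, and undoing the smoothing joins these walks into one.
  have hface : ¬ (D.edge * (D.smooth u).rot).SameCycle u (D.rot (D.rot u)) := by
    intro h'
    refine h ?_
    rw [conn_eq_sup]
    exact sameCycle_mul_le _ _ h'
  have h₂ := sameCycle_mul_swap hface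
  rw [mul_assoc, ← rot_eq_smooth_mul_swap] at h₂
  have h₃ : Perm.SameCycle.setoid (D.edge * D.rot) ≤ D.region :=
    sameCycle_le fun x => D.region.symm (hD.region_face x)
  exact h₃ h₂

/-- For Euler's formula: the vertices increase by one. If the smoothing disconnects nothing, it must
merge two different regions. If it splits a component, the merged corners already lie in one region,
and the new component compensates for the new vertex. -/
theorem smooth_isDiagram (hD : D.IsDiagram) (hu : D.IsCrossing u) : (D.smooth u).IsDiagram where
  finite := hD.finite
  nonempty := hD.nonempty
  edge_edge := hD.edge_edge
  edge_ne := hD.edge_ne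
  rot_four := smooth_rot_four hD hu
  rot_ne := smooth_rot_ne hD hu
  upper_rot x hx := by
    obtain ⟨hx₁, hx₂⟩ := (smooth_isCrossing hD hu).1 hx
    rw [smooth_rot_of_not_sameCycle hx₂]
    have := hD.upper_rot x hx₁
    simp only [smooth, Set.mem_ofPred_eq, hx₂, not_sameCycle_rot hx₂, not_false_eq_true, and_true]
    exact this
  upper_crossing x hx := (smooth_isCrossing hD hu).2 ⟨hD.upper_crossing x hx.1, hx.2⟩
  region_face := smooth_region_face hD
  region_conn := smooth_region_conn hD hu
  euler := by
    have := hD.finite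
    have := hD.nonempty
    have h₀ := hD.euler
    have h₁ := euler_inequality (D := (D.smooth u).toLinkData) hD.edge_edge hD.edge_ne
      (smooth_region_face hD) (smooth_region_conn hD hu)
    have h₂ := smooth_card_rot hD hu
    have h₃ : Nat.card (Quotient (Perm.SameCycle.setoid (D.smooth u).edge)) =
      Nat.card (Quotient (Perm.SameCycle.setoid D.edge)) := rfl
    have h₄ := conn_eq_glue_smooth hD hu
    rw [h₄] at h₀
    by_cases hc : (D.smooth u).conn u (D.rot (D.rot u))
    · rw [glue_eq_self hc] at h₀
      have h₅ : Nat.card (Quotient D.region) ≤ Nat.card (Quotient (D.smooth u).region) + 1 :=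
        card_quotient_le_glue _ _ _
      by_cases hr : D.region u (D.rot (D.rot u))
      · have h₆ : (D.smooth u).region = D.region := glue_eq_self hr
        rw [h₆] at h₁
        omega
      · have h₆ : Nat.card (Quotient (D.smooth u).region) + 1 = Nat.card (Quotient D.region) :=
          card_quotient_glue hr
        omega
    · have h₅ := card_quotient_glue hc
      have h₆ : (D.smooth u).region = D.region := glue_eq_self (region_of_not_smooth_conn hD hc)
      rw [h₆]
      omega

/-- Going straight on ties opposite darts of the crossing, and the new tie joins the two strands, so
all four darts lie in one class. At other vertices nothing changes. -/
theorem smooth_component_le (hD : D.IsDiagram) (hu : D.IsCrossing u)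
    (hc : D.component ≤ D.tie) : (D.smooth u).component ≤ (D.smooth u).tie := by
  have hle : D.tie ≤ (D.smooth u).tie := le_glue _ _ _
  have h₀ : ∀ x, D.IsCrossing x → (D.smooth u).tie x (D.rot (D.rot x)) := fun x hx =>
    hle (hc (through_of_isCrossing hx ▸ D.component_through x))
  have h₁ : (D.smooth u).tie u (D.rot u) := glue_self_rel _ _ _
  have h₂ : (D.smooth u).tie u (D.rot (D.rot u)) := h₀ u hu
  have h₃ : (D.smooth u).tie u (D.rot (D.rot (D.rot u))) :=
    Setoid.trans' _ h₁ (h₀ _ ((isCrossing_rot u).2 hu))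
  refine eqvGen_le ?_
  rintro x y (rfl | rfl)
  · exact hle (hc (D.component_edge x))
  · by_cases h : D.rot.SameCycle u x
    · rw [through_of_not_isCrossing (fun h' => ((smooth_isCrossing hD hu).1 h').2 h)]
      rcases (sameCycle_order_four hD.rot_four).1 h with rfl | rfl | rfl | rfl
      · rw [smooth_rot_self]; exact h₃
      · rw [smooth_rot_rot hD]; exact Setoid.trans' _ (Setoid.symm' _ h₁) h₂
      · rw [smooth_rot_rot_rot]; exact Setoid.trans' _ (Setoid.symm' _ h₂) h₁
      · rw [smooth_rot_rot_rot_rot hD]; exact Setoid.symm' _ h₃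
    · have : (D.smooth u).through x = D.through x := by
        by_cases hx : D.IsCrossing x
        · rw [through_of_isCrossing hx, through_of_isCrossing ((smooth_isCrossing hD hu).2 ⟨hx, h⟩),
            smooth_rot_of_not_sameCycle h, smooth_rot_of_not_sameCycle (not_sameCycle_rot h)]
        · rw [through_of_not_isCrossing hx, through_of_not_isCrossing
            (fun h' => hx ((smooth_isCrossing hD hu).1 h').1), smooth_rot_of_not_sameCycle h]
      rw [this]
      exact hle (hc (D.component_through x))

end TiedData

/-- The smoothing of a crossing of a tied link diagram. -/
noncomputable def TiedDiagram.smoothing {α : Type} (D : TiedDiagram α) {u : α}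
    (hu : D.IsCrossing u) : TiedDiagram α where
  toTiedData := D.smooth u
  isDiagram := TiedData.smooth_isDiagram D.isDiagram hu
  component_le := TiedData.smooth_component_le D.isDiagram hu D.component_le

/-! ## Isomorphic diagrams -/

section Iso

variable {α β : Type}

theorem sameCycle_setoid_eq_comap {φ : α ≃ β} {g : Perm α} {g' : Perm β}
    (h : ∀ x, g' (φ x) = φ (g x)) :
    Perm.SameCycle.setoid g = (Perm.SameCycle.setoid g').comap φ := by
  refine le_antisymm (sameCycle_le fun x => ?_) fun x y hxy => ?_
  · change g'.SameCycle (φ x) (φ (g x))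
    rw [← h]
    exact sameCycle_apply g' (φ x)
  · have : Perm.SameCycle.setoid g' ≤ (Perm.SameCycle.setoid g).comap φ.symm := by
      refine sameCycle_le fun y => ?_
      obtain ⟨x, rfl⟩ := φ.surjective y
      rw [Setoid.comap_rel, h, φ.symm_apply_apply, φ.symm_apply_apply]
      exact sameCycle_apply g x
    have h' := this hxy
    rwa [Setoid.comap_rel, φ.symm_apply_apply, φ.symm_apply_apply] at h'

theorem comap_sup_equiv (φ : α ≃ β) (r s : Setoid β) :
    r.comap φ ⊔ s.comap φ = (r ⊔ s).comap φ := by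
  refine le_antisymm (sup_le (fun x y h => (le_sup_left : r ≤ r ⊔ s) h)
    (fun x y h => (le_sup_right : s ≤ r ⊔ s) h)) fun x y hxy => ?_
  have : r ⊔ s ≤ (r.comap φ ⊔ s.comap φ).comap φ.symm := by
    refine sup_le (fun a b h => (le_sup_left : _ ≤ r.comap φ ⊔ s.comap φ) ?_)
      (fun a b h => (le_sup_right : _ ≤ r.comap φ ⊔ s.comap φ) ?_)
    · simpa [Setoid.comap_rel] using h
    · simpa [Setoid.comap_rel] using h
  have h' := this hxy
  rwa [Setoid.comap_rel, φ.symm_apply_apply, φ.symm_apply_apply] at h'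

namespace TiedData.IsIso

open LinkData

variable {φ : α ≃ β} {D : TiedData α} {D' : TiedData β}

theorem isCrossing (h : IsIso φ D D') (x : α) : D'.IsCrossing (φ x) ↔ D.IsCrossing x := by
  simp [IsCrossing, h.rot]

theorem region_eq (h : IsIso φ D D') : D.region = D'.region.comap φ :=
  Setoid.ext fun x y => (h.region x y).symm

theorem conn_eq (h : IsIso φ D D') : D.conn = D'.conn.comap φ := by
  rw [conn_eq_sup, conn_eq_sup, sameCycle_setoid_eq_comap h.edge, sameCycle_setoid_eq_comap h.rot,
    comap_sup_equiv]

/-- The isotopy rule compares bundled diagrams; this supplies planarity of the second one. -/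
theorem isDiagram (h : IsIso φ D D') (hD : D.IsDiagram) : D'.IsDiagram := by
  have hφ : ∀ s : Setoid β, Nat.card (Quotient (s.comap φ)) = Nat.card (Quotient s) := fun s =>
    card_quotient_comap φ fun y => ⟨φ.symm y, by rw [φ.apply_symm_apply]⟩
  have htop : D'.region ⊔ D'.conn = ⊤ := by
    have h' := hD.region_conn
    rw [h.region_eq, h.conn_eq, comap_sup_equiv, eq_top_iff] at h'
    rw [eq_top_iff]
    intro x y _
    have := h' (x := φ.symm x) (y := φ.symm y) trivial
    rwa [Setoid.comap_rel, φ.apply_symm_apply, φ.apply_symm_apply] at this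
  refine ⟨?_, ?_, ?_, ?_, ?_, ?_, ?_, ?_, ?_, htop, ?_⟩
  · have := hD.finite
    exact Finite.of_equiv α φ
  · exact hD.nonempty.map φ
  · exact φ.forall_congr_right.1 fun x => by rw [h.edge, h.edge, hD.edge_edge]
  · exact φ.forall_congr_right.1 fun x => by
      rw [h.edge]; exact fun e => hD.edge_ne x (φ.injective e)
  · exact φ.forall_congr_right.1 fun x => by rw [h.rot, h.rot, h.rot, h.rot, hD.rot_four]
  · exact φ.forall_congr_right.1 fun x => by
      rw [h.rot]; exact fun e => hD.rot_ne x (φ.injective e)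
  · exact φ.forall_congr_right.1 fun x => by
      rw [h.rot, h.upper, h.upper, h.isCrossing]; exact hD.upper_rot x
  · exact φ.forall_congr_right.1 fun x => by rw [h.upper, h.isCrossing]; exact hD.upper_crossing x
  · exact φ.forall_congr_right.1 fun x => by
      rw [h.rot, h.edge, h.region]; exact hD.region_face x
  · have := hD.euler
    rwa [h.region_eq, h.conn_eq, sameCycle_setoid_eq_comap h.edge, sameCycle_setoid_eq_comap h.rot,
      hφ, hφ, hφ, hφ] at this

theorem component_le (h : IsIso φ D D') (hD : D.component ≤ D.tie) :
    D'.component ≤ D'.tie := by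
  refine eqvGen_le fun x => ?_
  obtain ⟨x, rfl⟩ := φ.surjective x
  rintro y (rfl | rfl)
  · rw [h.edge, h.tie]
    exact hD (D.component_edge x)
  · have : D'.through (φ x) = φ (D.through x) := by
      by_cases hx : D.IsCrossing x
      · rw [through_of_isCrossing hx, through_of_isCrossing ((h.isCrossing x).2 hx), h.rot, h.rot]
      · rw [through_of_not_isCrossing hx,
          through_of_not_isCrossing (fun h' => hx ((h.isCrossing x).1 h')), h.rot]
    rw [this, h.tie]
    exact hD (D.component_through x)

/-- Diagrams isomorphic to tied link diagrams are tied link diagrams. -/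
def tiedDiagram {D : TiedDiagram α} (h : IsIso φ D.toTiedData D') : TiedDiagram β where
  toTiedData := D'
  isDiagram := h.isDiagram D.isDiagram
  component_le := h.component_le D.component_le

end TiedData.IsIso

end Iso

/-! ## Curls -/

section SumSetoid

variable {α β : Type} (r : Setoid α) (s : Setoid β)

theorem sumSetoid_inl_inl (a b : α) : sumSetoid r s (Sum.inl a) (Sum.inl b) ↔ r a b :=
  ⟨fun h => by cases h; assumption, .inl⟩

theorem sumSetoid_inr_inr (a b : β) : sumSetoid r s (Sum.inr a) (Sum.inr b) ↔ s a b :=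
  ⟨fun h => by cases h; assumption, .inr⟩

theorem sumSetoid_inl_inr (a : α) (b : β) : ¬ sumSetoid r s (Sum.inl a) (Sum.inr b) := nofun

theorem sumSetoid_inr_inl (a : α) (b : β) : ¬ sumSetoid r s (Sum.inr b) (Sum.inl a) := nofun

theorem bot_rel (a b : α) : (⊥ : Setoid α) a b ↔ a = b := Iff.rfl

theorem top_rel (a b : α) : (⊤ : Setoid α) a b := trivial

end SumSetoid

/-- The decidability instances may differ, as they can for the transpositions coming from `curl` and
from `smooth`. -/
theorem swap_mul_swap_self {α : Type} (i j : DecidableEq α) (a b : α) :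
    @swap α i a b * @swap α j a b = 1 := by
  rw [Subsingleton.elim i j, swap_mul_self]

section Curl

open TiedData LinkData

variable {α : Type}

theorem TiedDiagram.tie_rot_of_not_isCrossing (D : TiedDiagram α) {p : α}
    (hp : ¬ D.IsCrossing p) : D.tie p (D.rot p) :=
  D.component_le (through_of_not_isCrossing hp ▸ D.component_through p)

theorem TiedDiagram.tie_edge (D : TiedDiagram α) (p : α) : D.tie p (D.edge p) :=
  D.component_le (D.component_edge p)

theorem TiedDiagram.tie_rot_rot (D : TiedDiagram α) (p : α) : D.tie p (D.rot (D.rot p)) := by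
  by_cases hp : D.IsCrossing p
  · exact D.component_le (through_of_isCrossing hp ▸ D.component_through p)
  · rw [of_not_not hp]

/-- A smoothing merges two opposite corners and can be named by either. At a tied crossing neither
name adds a tie. -/
theorem TiedDiagram.smooth_rot_rot (D : TiedDiagram α) {u : α} (hu : D.tie u (D.rot u)) :
    D.smooth (D.rot (D.rot u)) = D.smooth u := by
  have h₁ : D.tie (D.rot (D.rot u)) (D.rot (D.rot (D.rot u))) :=
    Setoid.trans' _ (Setoid.symm' _ (D.tie_rot_rot u)) (Setoid.trans' _ hu (D.tie_rot_rot _))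
  have h₂ : ∀ x, D.rot.SameCycle (D.rot (D.rot u)) x ↔ D.rot.SameCycle u x := fun x => by
    rw [Perm.sameCycle_apply_left, Perm.sameCycle_apply_left]
  refine TiedData.ext rfl ?_ ?_ ?_ ?_
  · classical
    simp only [smooth, D.isDiagram.rot_four]
    rw [swap_comm]
  · simp only [smooth, h₂]
  · simp only [smooth, D.isDiagram.rot_four]
    exact glue_comm _ _ _
  · simp only [smooth]
    rw [glue_eq_self h₁, glue_eq_self hu]

variable {D : TiedDiagram α} {p : α} (pos : Bool)

theorem curl_rot_left : (D.curl pos p).rot (Sum.inl (D.rot p)) = Sum.inr false := by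
  simp [curl]

theorem curl_rot_false : (D.curl pos p).rot (Sum.inr false) = Sum.inr true := by
  classical
  simp [curl, swap_apply_def]

theorem curl_rot_true (hp : ¬ D.IsCrossing p) :
    (D.curl pos p).rot (Sum.inr true) = Sum.inl p := by
  simpa [curl] using of_not_not hp

theorem curl_rot_right : (D.curl pos p).rot (Sum.inl p) = Sum.inl (D.rot p) := by
  classical
  simp [curl, swap_apply_def, (D.isDiagram.rot_ne p).symm]

theorem curl_isCrossing (x : α ⊕ Bool)
    (hx : x = Sum.inl (D.rot p) ∨ x = Sum.inr false) (hp : ¬ D.IsCrossing p) :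
    (D.curl pos p).IsCrossing x := by
  rcases hx with rfl | rfl
  · simp [IsCrossing, curl_rot_left, curl_rot_false]
  · simp [IsCrossing, curl_rot_false, curl_rot_true pos hp]

/-- The smoothing of a curl which splits off a circle. -/
theorem curl_smooth_left (hp : ¬ D.IsCrossing p)
    (hK : ∀ x, (D.curl pos p).rot ((D.curl pos p).rot
      ((D.curl pos p).rot ((D.curl pos p).rot x))) = x) :
    (D.curl pos p).smooth (Sum.inl (D.rot p)) = D.addTiedCircle (D.rot p) p := by
  have hpq : D.tie p (D.rot p) := D.tie_rot_of_not_isCrossing hp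
  have hup : p ∉ D.upper := fun h => hp (D.isDiagram.upper_crossing p h)
  have huq : D.rot p ∉ D.upper := fun h =>
    hp ((isCrossing_rot p).1 (D.isDiagram.upper_crossing _ h))
  have hcyc : ∀ x, (D.curl pos p).rot.SameCycle (Sum.inl (D.rot p)) x ↔
      x = Sum.inl (D.rot p) ∨ x = Sum.inr false ∨ x = Sum.inr true ∨ x = Sum.inl p := fun x => by
    rw [sameCycle_order_four hK, curl_rot_left, curl_rot_false, curl_rot_true pos hp]
  refine TiedData.ext rfl ?_ ?_ ?_ ?_
  -- The curl was built by joining the cycles of `rot p` and `inr true`; this smoothing applies the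
  -- same transposition again and undoes it.
  · simp only [smooth, curl_rot_left, curl_rot_false]
    simp only [curl, addTiedCircle, addCircle]
    rw [mul_assoc, swap_mul_swap_self, mul_one]
  · ext x
    simp only [smooth, hcyc]
    rcases x with x | (_ | _)
    · simp only [curl, addTiedCircle, addCircle]
      constructor
      · rintro ⟨h | h, h'⟩
        · exact h
        · cases pos <;> simp at h h' <;> tauto
      · rintro ⟨y, hy, e⟩
        obtain rfl : y = x := Sum.inl.inj e
        refine ⟨.inl ⟨y, hy, rfl⟩, ?_⟩
        rintro (h | h | h | h) <;> simp at h <;> subst h <;> contradiction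
    · simp [addTiedCircle, addCircle]
    · simp [addTiedCircle, addCircle]
  -- The two corners to be merged were already put in one region when the curl was inserted.
  · simp only [smooth, curl_rot_left, curl_rot_false]
    exact glue_eq_self (glue_self_rel _ _ _)
  · simp only [smooth, curl_rot_left]
    rw [glue_eq_self]
    · ext x y
      change D.tie _ _ ↔ glue (sumSetoid D.tie ⊤) _ _ _ _
      rw [glue_rel_iff]
      rcases x with x | x <;> rcases y with y | y <;>
        simp [sumSetoid_inl_inl, sumSetoid_inr_inr, sumSetoid_inl_inr, sumSetoid_inr_inl, top_rel,
          Setoid.comm' D.tie (x := p)]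
    · exact Setoid.symm' _ hpq

open Classical in
/-- The smoothing of a curl which gives the arc with a further marked point. -/
theorem curl_smooth_right (hp : ¬ D.IsCrossing p)
    (hK : ∀ x, (D.curl pos p).rot ((D.curl pos p).rot
      ((D.curl pos p).rot ((D.curl pos p).rot x))) = x) :
    IsIso (swap (Sum.inr false) (Sum.inl p) * swap (Sum.inl p) (Sum.inr true))
      ((D.curl pos p).smooth (Sum.inr false)) (D.mark p) := by
  have hpp : D.rot (D.rot p) = p := of_not_not hp
  have hpq : D.tie p (D.rot p) := D.tie_rot_of_not_isCrossing hp
  have hne := D.isDiagram.rot_ne p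
  have hne' := D.isDiagram.edge_ne p
  have hup : p ∉ D.upper := fun h => hp (D.isDiagram.upper_crossing p h)
  have huq : D.rot p ∉ D.upper := fun h =>
    hp ((isCrossing_rot p).1 (D.isDiagram.upper_crossing _ h))
  have hcyc : ∀ x, (D.curl pos p).rot.SameCycle (Sum.inr false) x ↔
      x = Sum.inr false ∨ x = Sum.inr true ∨ x = Sum.inl p ∨ x = Sum.inl (D.rot p) := fun x => by
    rw [sameCycle_order_four hK, curl_rot_false, curl_rot_true pos hp, curl_rot_right]
  have hreg : D.region (D.edge p) (D.rot p) := by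
    have := D.isDiagram.region_face (D.rot p)
    rwa [hpp] at this
  -- Between `edge p` and `rot p`, the smoothed curl passes the darts `p`, `inr true`, `inr false`,
  -- and the marked arc passes `inr true`, `inr false`, `p`. Matching the positions gives this
  -- 3-cycle.
  obtain ⟨φ, hφ⟩ : ∃ φ, φ = swap (Sum.inr false) (Sum.inl p) *
      swap (Sum.inl p) (Sum.inr true : α ⊕ Bool) := ⟨_, rfl⟩
  rw [← hφ]
  have φp : φ (Sum.inl p) = Sum.inr true := by simp [hφ, swap_apply_def]
  have φt : φ (Sum.inr true) = Sum.inr false := by simp [hφ]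
  have φf : φ (Sum.inr false) = Sum.inl p := by simp [hφ, swap_apply_def]
  have φo : ∀ x, x ≠ p → φ (Sum.inl x) = Sum.inl x := fun x hx => by
    simp [hφ, swap_apply_def, hx]
  constructor
  · intro x
    have e₁ : ∀ z, ((D.curl pos p).smooth (Sum.inr false)).edge z = sumCongr D.edge boolNot z :=
      fun z => rfl
    rw [e₁]
    rcases x with x | (_ | _)
    · rcases eq_or_ne x p with rfl | hx
      · simp [φp, φo, hne', mark, swap_apply_def]
      · rcases eq_or_ne x (D.edge p) with rfl | hx'
        · simp [φp, φo, hne', mark, swap_apply_def, D.isDiagram.edge_edge]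
        · have : D.edge x ≠ p := fun e => hx' (by rw [← e, D.isDiagram.edge_edge])
          simp [φo, hx, hx', this, mark, swap_apply_def]
    · simp [φt, φf, mark, swap_apply_def, hne'.symm]
    · simp [φt, φf, mark, swap_apply_def, hne'.symm, D.isDiagram.edge_edge]
  · have hT : (D.curl pos p).rot ((D.curl pos p).rot (Sum.inr false)) = Sum.inl p := by
      rw [curl_rot_false, curl_rot_true pos hp]
    intro x
    have e₁ : ∀ z, (D.mark p).rot z = sumCongr D.rot boolNot z := fun z => rfl
    rw [e₁]
    rcases x with x | (_ | _)
    · rcases eq_or_ne x p with rfl | hx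
      · conv_rhs => rw [← hT, smooth_rot_rot_rot]
        rw [curl_rot_false, φp, φt]
        rfl
      · rw [φo x hx, smooth_rot_of_ne (by simp) (by rw [hT]; simpa using hx)]
        rcases eq_or_ne x (D.rot p) with rfl | hx'
        · rw [curl_rot_left, φf]
          simp [hpp]
        · have : D.rot x ≠ p := fun e => hx' (D.rot.injective (by rw [e, hpp]))
          have e₂ : (D.curl pos p).rot (Sum.inl x) = Sum.inl (D.rot x) := by
            simp [curl, swap_apply_def, hx']
          rw [e₂, φo _ this]
          rfl
    · rw [smooth_rot_self, hT, curl_rot_right, φf, φo _ hne]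
      rfl
    · rw [smooth_rot_of_ne (by simp) (by rw [hT]; simp), curl_rot_true pos hp, φt, φp]
      rfl
  · intro x
    simp only [smooth, hcyc]
    rcases x with x | (_ | _)
    · rcases eq_or_ne x p with rfl | hx
      · simp [φp, mark]
      · rw [φo x hx]
        rcases eq_or_ne x (D.rot p) with rfl | hx'
        · simp [mark, huq]
        · cases pos <;> simp [mark, curl, hx, hx']
    · simp [φf, mark, hup]
    · simp [φt, mark]
  · let s := glue (glue (sumSetoid D.region ⊥) (Sum.inl (D.rot p)) (Sum.inr true))
      (Sum.inr false) (Sum.inl p)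
    have hs : ((D.curl pos p).smooth (Sum.inr false)).region = s := by
      simp only [smooth, curl_rot_false, curl_rot_true pos hp]
      rfl
    -- Each new dart is sent to a dart of `D` with the same region on its left, so the glued
    -- relation `s` is the pullback of the regions of `D`. The map `μ` below does this for the
    -- marked diagram, and `hreg` reconciles the two choices.
    let ρ : α ⊕ Bool → α := Sum.elim id (fun b => cond b (D.rot p) p)
    have h₁ : s ≤ D.region.comap ρ := by
      refine glue_le_iff.2 ⟨glue_le_iff.2 ⟨?_, D.region.refl _⟩, D.region.refl _⟩
      rintro _ _ (h | h)
      · exact h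
      · rw [(bot_rel _ _).1 h]
    have h₂ : ∀ a, s a (Sum.inl (ρ a)) := by
      rintro (a | _ | _)
      · exact s.refl _
      · exact glue_self_rel _ _ _
      · exact s.symm (le_glue _ _ _ (glue_self_rel _ _ _))
    have h₃ : ∀ a b, s a b ↔ D.region (ρ a) (ρ b) := fun a b =>
      ⟨fun h => h₁ h, fun h => s.trans (h₂ a) (s.trans
        (le_glue _ _ _ (le_glue _ _ _ (Sum.LiftRel.inl h))) (s.symm (h₂ b)))⟩
    let μ : α ⊕ Bool → α := Sum.elim id (fun b => cond b p (D.edge p))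
    have h₄ : ∀ a, D.region (μ (φ a)) (ρ a) := by
      rintro (a | _ | _)
      · rcases eq_or_ne a p with rfl | ha
        · rw [φp]
          exact D.region.refl _
        · rw [φo a ha]
          exact D.region.refl _
      · rw [φf]
        exact D.region.refl _
      · rw [φt]
        exact hreg
    intro x y
    rw [hs, h₃]
    exact ⟨fun h => D.region.trans (D.region.symm (h₄ x)) (D.region.trans h (h₄ y)),
      fun h => D.region.trans (h₄ x) (D.region.trans h (D.region.symm (h₄ y)))⟩
  · let ρ : α ⊕ Bool → α := Sum.elim id (fun _ => p)
    have hs : ((D.curl pos p).smooth (Sum.inr false)).tie = D.tie.comap ρ := by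
      simp only [smooth, curl_rot_false]
      exact glue_eq_self (D.tie.refl p)
    let μ : α ⊕ Bool → α := Sum.elim id (fun b => cond b p (D.edge p))
    have h₄ : ∀ a, D.tie (μ (φ a)) (ρ a) := by
      rintro (a | _ | _)
      · rcases eq_or_ne a p with rfl | ha
        · rw [φp]
          exact D.tie.refl _
        · rw [φo a ha]
          exact D.tie.refl _
      · rw [φf]
        exact D.tie.refl _
      · rw [φt]
        exact D.tie.symm (D.tie_edge p)
    intro x y
    rw [hs]
    exact ⟨fun h => D.tie.trans (D.tie.symm (h₄ x)) (D.tie.trans h (h₄ y)),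
      fun h => D.tie.trans (h₄ x) (D.tie.trans h (D.tie.symm (h₄ y)))⟩

end Curl

theorem varA_mul_varAInv : varA * varAInv = 1 := by
  rw [varA, varAInv, ← C_mul, ← LaurentPolynomial.T_add]
  simp

/-! ### The bracket of a curl -/

section

variable {f : ∀ α : Type, TiedDiagram α → (LaurentPolynomial ℤ)[X]} {α : Type}

theorem IsTiedBracket.curl (hf : IsTiedBracket f) (D : TiedDiagram α) (p : α)
    (K : TiedDiagram (α ⊕ Bool)) (hp : ¬ D.IsCrossing p) (pos : Bool)
    (hK : K.toTiedData = D.curl pos p) :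
    f _ K = cond pos (-varA ^ 3) (-varAInv ^ 3) * f α D := by
  have hpq : D.tie p (D.rot p) := D.tie_rot_of_not_isCrossing hp
  have hrot : K.rot = (D.curl pos p).rot := by rw [hK]
  have hK₄ := K.isDiagram.rot_four
  rw [hrot] at hK₄
  have hcr : ∀ x, x = Sum.inl (D.rot p) ∨ x = Sum.inr false → K.IsCrossing x := fun x hx => by
    rw [hK]; exact curl_isCrossing pos x hx hp
  have hcq := hcr _ (.inl rfl)
  have hcx := hcr _ (.inr rfl)
  have htq : K.tie (Sum.inl (D.rot p)) (K.rot (Sum.inl (D.rot p))) := by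
    rw [hrot, curl_rot_left, hK]
    exact D.tie.symm hpq
  have htx : K.tie (Sum.inr false) (K.rot (Sum.inr false)) := by
    rw [hrot, curl_rot_false, hK]
    exact D.tie.refl p
  have hq : K.smooth (Sum.inl (D.rot p)) = D.addTiedCircle (D.rot p) p := by
    rw [hK]
    exact curl_smooth_left pos hp hK₄
  have hx := curl_smooth_right pos hp hK₄
  rw [← hK] at hx
  have hfq : f _ (K.smoothing hcq) = -(varA ^ 2 + varAInv ^ 2) * f α D :=
    hf.addTiedCircle _ _ _ _ _ hq
  have hfx : f _ (K.smoothing hcx) = f α D :=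
    (hf.iso _ _ _ (K.smoothing hcx) (TiedData.IsIso.tiedDiagram (D := K.smoothing hcx) hx)
      hx).symm.trans (hf.mark _ _ _ p rfl)
  have h1 := varA_mul_varAInv
  have hup : K.upper = (D.curl pos p).upper := by rw [hK]
  cases pos
  · have h := hf.skein_tied _ K (K.smoothing hcx) (K.smoothing hcq) (Sum.inr false) hcx
      -- The `B`-smoothing is named by `inr true`, the dart opposite to `rot p`, so it is the one
      -- that splits off the circle.
      (by simp [hup, TiedData.curl]) htx rfl (by
        have e : K.rot (Sum.inr false) = K.rot (K.rot (Sum.inl (D.rot p))) := by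
          rw [hrot, curl_rot_left]
        rw [e, TiedDiagram.smooth_rot_rot _ htq]
        rfl)
    rw [h, hfx, hfq, cond_false]
    linear_combination (-varA) * f α D * h1
  · have h := hf.skein_tied _ K (K.smoothing hcq) (K.smoothing hcx) (Sum.inl (D.rot p)) hcq
      (by simp [hup, TiedData.curl]) htq rfl (by rw [hrot, curl_rot_left]; rfl)
    rw [h, hfx, hfq, cond_true]
    linear_combination (-varAInv) * f α D * h1

end

/-! ## Diagrams without crossings -/

namespace LinkData

variable {α : Type} {D : LinkData α}

/-- Without crossings, vertices and edges both have two darts, so `V = E` and Euler's formula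
becomes `R = C + 1`. -/
theorem card_region_of_forall_not_isCrossing (hD : D.IsDiagram) (hc : ∀ x, ¬ D.IsCrossing x) :
    Nat.card (Quotient D.region) = Nat.card (Quotient D.conn) + 1 := by
  have := hD.finite
  have h₁ := two_mul_card_cycles_involution (fun x => of_not_not (hc x)) hD.rot_ne
  have h₂ := two_mul_card_cycles_involution hD.edge_edge hD.edge_ne
  have h₃ := hD.euler
  omega

theorem isDiagram_of_forall_not_isCrossing [Finite α] [Nonempty α]
    (hc : ∀ x, ¬ D.IsCrossing x) (hee : ∀ x, D.edge (D.edge x) = x) (hne : ∀ x, D.edge x ≠ x)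
    (hrne : ∀ x, D.rot x ≠ x) (hup : D.upper = ∅) (hface : ∀ x, D.region (D.edge (D.rot x)) x)
    (hconn : D.region ⊔ D.conn = ⊤)
    (hcard : Nat.card (Quotient D.region) = Nat.card (Quotient D.conn) + 1) :
    D.IsDiagram where
  finite := inferInstance
  nonempty := inferInstance
  edge_edge := hee
  edge_ne := hne
  rot_four x := by rw [of_not_not (hc x), of_not_not (hc x)]
  rot_ne := hrne
  upper_rot x hx := (hc x hx).elim
  upper_crossing x hx := by simp [hup] at hx
  region_face := hface
  region_conn := hconn
  euler := by
    have h₁ := two_mul_card_cycles_involution (fun x => of_not_not (hc x)) hrne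
    have h₂ := two_mul_card_cycles_involution hee hne
    omega

theorem upper_eq_empty (hD : D.IsDiagram) (hc : ∀ x, ¬ D.IsCrossing x) : D.upper = ∅ :=
  Set.eq_empty_of_forall_notMem fun x hx => hc x (hD.upper_crossing x hx)

end LinkData

/-! ### Adding and removing pairs of darts -/

namespace TiedData

open LinkData

variable {α β : Type}

theorem IsIso.symm {φ : α ≃ β} {D : TiedData α} {D' : TiedData β} (h : IsIso φ D D') :
    IsIso φ.symm D' D where
  edge := φ.forall_congr_right.1 fun x => by simp [h.edge]
  rot := φ.forall_congr_right.1 fun x => by simp [h.rot]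
  upper := φ.forall_congr_right.1 fun x => by simp [h.upper]
  region := φ.forall_congr_right.1 fun x => φ.forall_congr_right.1 fun y => by simp [h.region]
  tie := φ.forall_congr_right.1 fun x => φ.forall_congr_right.1 fun y => by simp [h.tie]

section Mark

variable {D : TiedData α} {p : α}

theorem mark_edge_self (hne : ∀ x, D.edge x ≠ x) :
    (D.mark p).edge (Sum.inl p) = Sum.inr false := by
  simp [mark, swap_apply_def, (hne p).symm]

theorem mark_edge_edge : (D.mark p).edge (Sum.inl (D.edge p)) = Sum.inr true := by
  simp [mark, swap_apply_def]

theorem mark_edge_false (he : ∀ x, D.edge (D.edge x) = x) (hne : ∀ x, D.edge x ≠ x) :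
    (D.mark p).edge (Sum.inr false) = Sum.inl p := by
  simp [mark, swap_apply_def, he, (hne p).symm]

theorem mark_edge_true : (D.mark p).edge (Sum.inr true) = Sum.inl (D.edge p) := by
  simp [mark, swap_apply_def]

theorem mark_edge_of_ne {x : α} (h : x ≠ p)
    (h' : x ≠ D.edge p) : (D.mark p).edge (Sum.inl x) = Sum.inl (D.edge x) := by
  have h'' : D.edge x ≠ D.edge p := fun e => h (D.edge.injective e)
  simp [mark, swap_apply_def, h', h'']

end Mark

/-- A set with two distinct points `a` and `b` as a disjoint union. -/
noncomputable def pairEquiv {a b : α} (hab : a ≠ b) : {x // x ≠ a ∧ x ≠ b} ⊕ Bool ≃ α :=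
  Equiv.ofBijective (Sum.elim Subtype.val (fun i => cond i b a)) (by
    constructor
    · rintro (⟨x, hx⟩ | _ | _) (⟨y, hy⟩ | _ | _) h
      · exact congrArg Sum.inl (Subtype.ext h)
      · exact (hx.1 h).elim
      · exact (hx.2 h).elim
      · exact (hy.1 h.symm).elim
      · rfl
      · exact (hab h).elim
      · exact (hy.2 h.symm).elim
      · exact (hab h.symm).elim
      · rfl
    · intro x
      by_cases hxa : x = a
      · exact ⟨Sum.inr false, hxa.symm⟩
      · by_cases hxb : x = b
        · exact ⟨Sum.inr true, hxb.symm⟩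
        · exact ⟨Sum.inl ⟨x, hxa, hxb⟩, rfl⟩)

theorem ne_and_ne_iff_of_involution {e : Perm α} (he : ∀ x, e (e x) = x) {a b : α}
    (hab : e a = b) (x : α) : (e x ≠ a ∧ e x ≠ b) ↔ (x ≠ a ∧ x ≠ b) := by
  have hba : e b = a := by rw [← hab, he]
  have h₁ : e x = a ↔ x = b := by rw [← hba, e.injective.eq_iff]
  have h₂ : e x = b ↔ x = a := by rw [← hab, e.injective.eq_iff]
  simp only [ne_eq, h₁, h₂]
  tauto

/-- The data without crossings obtained by removing the darts `a` and `b`, with the involution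
`e` giving the new edges. -/
def removePair (D : TiedData α) {a b : α} {e : Perm α} (he : ∀ x, e (e x) = x) (heab : e a = b)
    (hr : ∀ x, D.rot (D.rot x) = x) (hrab : D.rot a = b) : TiedData {x // x ≠ a ∧ x ≠ b} where
  edge := e.subtypePerm (ne_and_ne_iff_of_involution he heab)
  rot := D.rot.subtypePerm (ne_and_ne_iff_of_involution hr hrab)
  upper := ∅
  region := D.region.comap Subtype.val
  tie := ⊤

end TiedData

open TiedData LinkData

variable {α : Type}

/-- In a diagram without crossings, a marked point can be removed from a circle with several
marked points. -/
theorem exists_isIso_mark (D : TiedDiagram α) (hc : ∀ x, ¬ D.IsCrossing x) (ht : D.tie = ⊤)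
    {a : α} (ha : D.edge a ≠ D.rot a) :
    ∃ (D₀ : TiedDiagram {x // x ≠ a ∧ x ≠ D.rot a}) (p : {x // x ≠ a ∧ x ≠ D.rot a})
      (φ : {x // x ≠ a ∧ x ≠ D.rot a} ⊕ Bool ≃ α),
      (∀ x, ¬ D₀.IsCrossing x) ∧ D₀.tie = ⊤ ∧
      Nat.card (Quotient D₀.conn) = Nat.card (Quotient D.conn) ∧
      IsIso φ (D₀.mark p) D.toTiedData := by
  classical
  have hD := D.isDiagram
  have := hD.finite
  have hrr : ∀ x, D.rot (D.rot x) = x := fun x => of_not_not (hc x)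
  obtain ⟨b, hb⟩ : ∃ b, b = D.rot a := ⟨_, rfl⟩
  obtain ⟨r, hr⟩ : ∃ r, r = D.edge a := ⟨_, rfl⟩
  obtain ⟨s, hs⟩ : ∃ s, s = D.edge b := ⟨_, rfl⟩
  have hrb : D.rot b = a := by rw [hb, hrr]
  have hea : D.edge a = r := hr.symm
  have heb : D.edge b = s := hs.symm
  have her : D.edge r = a := by rw [hr, hD.edge_edge]
  have hes : D.edge s = b := by rw [hs, hD.edge_edge]
  have hra : D.rot a = b := hb.symm
  rw [hra, hea] at ha
  rw [hra]
  have hab : a ≠ b := hb ▸ (hD.rot_ne a).symm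
  have hra' : r ≠ a := hr ▸ hD.edge_ne a
  have hsb : s ≠ b := hs ▸ hD.edge_ne b
  have hsa : s ≠ a := fun e => ha (by rw [← hea, ← e, hes])
  have hrs : r ≠ s := fun e => hab (by rw [← her, e, hes])
  -- The edges `a–r` and `b–s` meet at the marked point of `a` and `b`. Conjugation by `swap r b`
  -- turns them into `a–b` and `r–s`, and `r–s` is the edge left when that point is erased.
  obtain ⟨e, he⟩ : ∃ e, e = swap r b * D.edge * swap r b := ⟨_, rfl⟩
  have ea : e a = b := by simp [he, swap_apply_of_ne_of_ne hra'.symm hab, hea]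
  have eb : e b = a := by simp [he, swap_apply_of_ne_of_ne hra'.symm hab, her]
  have er : e r = s := by simp [he, swap_apply_of_ne_of_ne hrs.symm hsb, heb]
  have es : e s = r := by simp [he, swap_apply_of_ne_of_ne hrs.symm hsb, hes]
  have eo : ∀ x, x ≠ a → x ≠ b → x ≠ r → x ≠ s → e x = D.edge x := by
    intro x h₁ h₂ h₃ h₄
    have h₅ : D.edge x ≠ r := fun h => h₁ (by rw [← her, ← h, hD.edge_edge])
    have h₆ : D.edge x ≠ b := fun h => h₄ (by rw [hs, ← h, hD.edge_edge])
    simp [he, swap_apply_of_ne_of_ne h₃ h₂, swap_apply_of_ne_of_ne h₅ h₆]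
  have hee : ∀ x, e (e x) = x := fun x => by simp [he, hD.edge_edge]
  have hene : ∀ x, e x ≠ x := by
    intro x h
    have h' : D.edge (swap r b x) = swap r b x := by
      simpa [he, swap_apply_eq_iff] using h
    exact hD.edge_ne _ h'
  let D₀ := D.removePair hee ea hrr hra
  have hface : ∀ x, D.region (D.edge (D.rot x)) x := hD.region_face
  have has : D.region a s := by
    have := hface a
    rw [hra, heb] at this
    exact D.region.symm this
  have hbr : D.region b r := by
    have := hface b
    rw [hrb, hea] at this
    exact D.region.symm this
  let r₀ : {x // x ≠ a ∧ x ≠ b} := ⟨r, hra', ha⟩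
  let s₀ : {x // x ≠ a ∧ x ≠ b} := ⟨s, hsa, hsb⟩
  -- Two retractions onto the remaining darts are needed. `ρ` moves `a` and `b` along their edges,
  -- staying in the connected component; `ρ'` moves them to darts of the same region. Their values
  -- differ at most by the new edge `r–s`.
  let ρ : α → {x // x ≠ a ∧ x ≠ b} := fun x =>
    if h₁ : x = a then r₀ else if h₂ : x = b then s₀ else ⟨x, h₁, h₂⟩
  let ρ' : α → {x // x ≠ a ∧ x ≠ b} := fun x =>
    if h₁ : x = a then s₀ else if h₂ : x = b then r₀ else ⟨x, h₁, h₂⟩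
  have ρa : ρ a = r₀ := dif_pos rfl
  have ρb : ρ b = s₀ := by simp [ρ, hab.symm]
  have ρo : ∀ x (h₁ : x ≠ a) (h₂ : x ≠ b), ρ x = ⟨x, h₁, h₂⟩ := fun x h₁ h₂ => by simp [ρ, h₁, h₂]
  have ρ'a : ρ' a = s₀ := dif_pos rfl
  have ρ'b : ρ' b = r₀ := by simp [ρ', hab.symm]
  have ρ'o : ∀ x (h₁ : x ≠ a) (h₂ : x ≠ b), ρ' x = ⟨x, h₁, h₂⟩ := fun x h₁ h₂ => by
    simp [ρ', h₁, h₂]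
  have hers : D₀.edge r₀ = s₀ := Subtype.ext er
  have hconn_rs : D₀.conn r₀ s₀ := hers ▸ D₀.conn_edge r₀
  have hregρ' : ∀ x, D.region x (ρ' x) := by
    intro x
    by_cases h₁ : x = a
    · subst h₁; rw [ρ'a]; exact has
    · by_cases h₂ : x = b
      · subst h₂; rw [ρ'b]; exact hbr
      · rw [ρ'o x h₁ h₂]
  have hconnρ : ∀ x, D.conn x (ρ x) := by
    intro x
    by_cases h₁ : x = a
    · rw [h₁, ρa]; change D.conn a r; exact hea ▸ D.conn_edge a
    · by_cases h₂ : x = b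
      · rw [h₂, ρb]; change D.conn b s; exact heb ▸ D.conn_edge b
      · rw [ρo x h₁ h₂]
  have hconn_le : D.conn ≤ D₀.conn.comap ρ := by
    refine conn_le (fun x => ?_) (fun x => ?_)
    · rw [Setoid.comap_rel]
      by_cases h₁ : x = a
      · rw [h₁, hea, ρa, ρo r hra' ha]
      · by_cases h₂ : x = b
        · rw [h₂, heb, ρb, ρo s hsa hsb]
        · by_cases h₃ : x = r
          · rw [h₃, her, ρa, ρo r hra' ha]
          · by_cases h₄ : x = s
            · rw [h₄, hes, ρb, ρo s hsa hsb]
            · have : ρ (D.edge x) = D₀.edge (ρ x) := by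
                have h₅ := (ne_and_ne_iff_of_involution hee ea x).2 ⟨h₁, h₂⟩
                rw [eo x h₁ h₂ h₃ h₄] at h₅
                rw [ρo x h₁ h₂, ρo _ h₅.1 h₅.2]
                exact Subtype.ext (eo x h₁ h₂ h₃ h₄).symm
              rw [this]
              exact D₀.conn_edge _
    · rw [Setoid.comap_rel]
      by_cases h₁ : x = a
      · rw [h₁, hra, ρa, ρb]
        exact hconn_rs
      · by_cases h₂ : x = b
        · rw [h₂, hrb, ρa, ρb]
          exact D₀.conn.symm hconn_rs
        · have : ρ (D.rot x) = D₀.rot (ρ x) := by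
            have h₅ := (ne_and_ne_iff_of_involution hrr hra x).2 ⟨h₁, h₂⟩
            rw [ρo x h₁ h₂, ρo _ h₅.1 h₅.2]
            rfl
          rw [this]
          exact D₀.conn_rot _
  have hconn_eq : D₀.conn = D.conn.comap Subtype.val := by
    refine le_antisymm (conn_le (fun x => ?_) (fun x => D.conn_rot x)) fun x y h => ?_
    · change D.conn x (e x)
      by_cases h₃ : (x : α) = r
      · rw [h₃, er]
        exact D.conn.trans (her ▸ D.conn_edge r) (D.conn.trans (hra ▸ D.conn_rot a)
          (heb ▸ D.conn_edge b))
      · by_cases h₄ : (x : α) = s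
        · rw [h₄, es]
          exact D.conn.trans (hes ▸ D.conn_edge s) (D.conn.trans (hrb ▸ D.conn_rot b)
            (hea ▸ D.conn_edge a))
        · rw [eo x x.2.1 x.2.2 h₃ h₄]
          exact D.conn_edge x
    · have := hconn_le h
      rwa [Setoid.comap_rel, ρo x x.2.1 x.2.2, ρo y y.2.1 y.2.2] at this
  have hcard_conn : Nat.card (Quotient D₀.conn) = Nat.card (Quotient D.conn) := by
    rw [hconn_eq]
    exact card_quotient_comap _ fun y => ⟨ρ y, D.conn.symm (hconnρ y)⟩
  have hcard_region : Nat.card (Quotient D₀.region) = Nat.card (Quotient D.region) :=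
    card_quotient_comap _ fun y => ⟨ρ' y, D.region.symm (hregρ' y)⟩
  have hc₀ : ∀ x, ¬ D₀.IsCrossing x := fun x => not_not.2 (Subtype.ext (hrr x))
  have hρρ' : ∀ x, D₀.conn (ρ x) (ρ' x) := by
    intro x
    by_cases h₁ : x = a
    · subst h₁; rw [ρa, ρ'a]; exact hconn_rs
    · by_cases h₂ : x = b
      · subst h₂; rw [ρb, ρ'b]; exact D₀.conn.symm hconn_rs
      · rw [ρo x h₁ h₂, ρ'o x h₁ h₂]
  have hee₀ : ∀ x, D₀.edge (D₀.edge x) = x := fun x => Subtype.ext (hee x)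
  have hene₀ : ∀ x, D₀.edge x ≠ x := fun x h => hene x (congrArg Subtype.val h)
  have hdiag : D₀.IsDiagram := by
    have : Nonempty {x // x ≠ a ∧ x ≠ b} := ⟨r₀⟩
    refine isDiagram_of_forall_not_isCrossing hc₀ hee₀ hene₀
      (fun x h => hD.rot_ne x (congrArg Subtype.val h)) rfl (fun x => ?_) ?_ ?_
    · change D.region (e (D.rot x)) x
      have hx := (ne_and_ne_iff_of_involution hrr hra x).2 x.2
      by_cases h₃ : D.rot x = r
      · rw [h₃, er]
        have := hface x
        rw [h₃, her] at this
        exact D.region.trans (D.region.symm has) this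
      · by_cases h₄ : D.rot x = s
        · rw [h₄, es]
          have := hface x
          rw [h₄, hes] at this
          exact D.region.trans (D.region.symm hbr) this
        · rw [eo _ hx.1 hx.2 h₃ h₄]
          exact hface x
    · have hle : (⊤ : Setoid α) ≤ (D₀.region ⊔ D₀.conn).comap ρ := by
        rw [← hD.region_conn]
        refine sup_le (fun x y h => ?_)
          (hconn_le.trans fun x y h => (le_sup_right : D₀.conn ≤ D₀.region ⊔ D₀.conn) h)
        have hc' : ∀ x, (D₀.region ⊔ D₀.conn) (ρ x) (ρ' x) := fun x =>
          (le_sup_right : D₀.conn ≤ D₀.region ⊔ D₀.conn) (hρρ' x)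
        refine Setoid.trans' (D₀.region ⊔ D₀.conn) (hc' x)
          (Setoid.trans' _ (y := ρ' y) ?_ (Setoid.symm' (D₀.region ⊔ D₀.conn) (hc' y)))
        refine (le_sup_left : D₀.region ≤ D₀.region ⊔ D₀.conn) ?_
        exact D.region.trans (D.region.symm (hregρ' x)) (D.region.trans h (hregρ' y))
      rw [eq_top_iff]
      intro x y _
      have := hle (x := (x : α)) (y := y) trivial
      rwa [Setoid.comap_rel, ρo x x.2.1 x.2.2, ρo y y.2.1 y.2.2] at this
    · rw [hcard_conn, hcard_region]
      exact card_region_of_forall_not_isCrossing hD hc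
  refine ⟨⟨D₀, hdiag, le_top⟩, r₀, pairEquiv hab, hc₀, rfl, hcard_conn, ?_⟩
  change IsIso (pairEquiv hab) (D₀.mark r₀) D.toTiedData
  constructor
  · rintro (x | _ | _)
    · by_cases h₃ : x = r₀
      · rw [h₃, mark_edge_self hene₀]
        exact her
      · by_cases h₄ : x = s₀
        · rw [h₄, ← hers, mark_edge_edge, hers]
          exact hes
        · rw [mark_edge_of_ne h₃ (hers ▸ h₄)]
          exact (eo x x.2.1 x.2.2 (fun h => h₃ (Subtype.ext h)) (fun h => h₄ (Subtype.ext h))).symm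
    · rw [mark_edge_false hee₀ hene₀]
      exact hea
    · rw [mark_edge_true, hers]
      exact heb
  · rintro (x | _ | _)
    · rfl
    · exact hra
    · exact hrb
  · intro x
    rw [upper_eq_empty hD hc]
    simp [D₀, mark, removePair]
  · let μ : {x // x ≠ a ∧ x ≠ b} ⊕ Bool → {x // x ≠ a ∧ x ≠ b} :=
      Sum.elim id (fun b => cond b r₀ (D₀.edge r₀))
    have hμ : ∀ x, D.region (pairEquiv hab x) (μ x) := by
      rintro (x | _ | _)
      · exact D.region.refl _
      · simp only [μ, Sum.elim_inr, cond_false, hers]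
        exact has
      · exact hbr
    intro x y
    exact ⟨fun h => D.region.trans (D.region.symm (hμ x)) (D.region.trans h (hμ y)),
      fun h => D.region.trans (hμ x) (D.region.trans h (D.region.symm (hμ y)))⟩
  · intro x y
    rw [ht]
    exact Iff.rfl

theorem card_conn_of_edge_eq_rot {D : LinkData α} [Finite α] (her : D.edge = D.rot)
    (hee : ∀ x, D.edge (D.edge x) = x) (hne : ∀ x, D.edge x ≠ x) :
    2 * Nat.card (Quotient D.conn) = Nat.card α := by
  rw [conn_eq_sup, ← her, sup_idem]
  exact two_mul_card_cycles_involution hee hne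

/-- In a diagram consisting of circles with one marked point each, a circle which bounds an empty
disc can be removed. -/
theorem exists_isIso_addTiedCircle (D : TiedDiagram α) (hc : ∀ x, ¬ D.IsCrossing x)
    (ht : D.tie = ⊤) (her : D.edge = D.rot) {x p : α} (hx : ∀ z, D.region x z → z = x)
    (hpx : p ≠ x) (hpy : p ≠ D.rot x) (hp : D.region (D.rot x) p) :
    ∃ (D₀ : TiedDiagram {z // z ≠ x ∧ z ≠ D.rot x}) (p : {z // z ≠ x ∧ z ≠ D.rot x})
      (φ : {z // z ≠ x ∧ z ≠ D.rot x} ⊕ Bool ≃ α),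
      (∀ z, ¬ D₀.IsCrossing z) ∧ D₀.tie = ⊤ ∧
      Nat.card (Quotient D₀.conn) + 1 = Nat.card (Quotient D.conn) ∧
      IsIso φ (D₀.addTiedCircle p p) D.toTiedData := by
  classical
  have hD := D.isDiagram
  have := hD.finite
  have hrr : ∀ x, D.rot (D.rot x) = x := fun x => of_not_not (hc x)
  obtain ⟨y, hy⟩ : ∃ y, y = D.rot x := ⟨_, rfl⟩
  have hrx : D.rot x = y := hy.symm
  have hry : D.rot y = x := by rw [hy, hrr]
  rw [hrx] at hpy hp ⊢
  have hxy : x ≠ y := hy ▸ (hD.rot_ne x).symm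
  let D₀ := D.removePair hrr hrx hrr hrx
  let p₀ : {z // z ≠ x ∧ z ≠ y} := ⟨p, hpx, hpy⟩
  have hee₀ : ∀ z, D₀.edge (D₀.edge z) = z := fun z => Subtype.ext (hrr z)
  have hne₀ : ∀ z, D₀.edge z ≠ z := fun z h => hD.rot_ne z (congrArg Subtype.val h)
  have hcard : Nat.card (Quotient D₀.conn) + 1 = Nat.card (Quotient D.conn) := by
    -- Each circle has exactly two darts here, so removing two darts removes one circle.
    have h₁ := card_conn_of_edge_eq_rot her hD.edge_edge hD.edge_ne
    have h₂ := card_conn_of_edge_eq_rot (D := D₀.toLinkData) rfl hee₀ hne₀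
    have h₃ := Nat.card_congr (pairEquiv hxy)
    rw [Nat.card_sum, Nat.card_eq_fintype_card (α := Bool), Fintype.card_bool] at h₃
    omega
  let s : Setoid ({z // z ≠ x ∧ z ≠ y} ⊕ Bool) :=
    glue (sumSetoid D₀.region ⊥) (Sum.inl p₀) (Sum.inr true)
  have hs : s = D.region.comap (pairEquiv hxy) := by
    refine le_antisymm (glue_le_iff.2 ⟨?_, D.region.symm hp⟩) ?_
    · rintro _ _ (h | h)
      · exact h
      · rw [(bot_rel _ _).1 h]
    -- The dart `inr false` corresponds to `x`, alone in its region, the empty disc. All other darts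
    -- can be moved to `D₀` within their region, `rot x` going to `p`.
    · let κ : {z // z ≠ x ∧ z ≠ y} ⊕ Bool → {z // z ≠ x ∧ z ≠ y} := Sum.elim id (fun _ => p₀)
      have hκ : ∀ a, a ≠ Sum.inr false →
          s a (Sum.inl (κ a)) ∧ D.region (pairEquiv hxy a) (κ a) := by
        rintro (a | _ | _) ha
        · exact ⟨s.refl _, D.region.refl _⟩
        · exact (ha rfl).elim
        · exact ⟨s.symm (glue_self_rel _ _ _), hp⟩
      intro a b h
      by_cases ha : a = Sum.inr false
      · rw [ha] at h ⊢
        have e : b = Sum.inr false := (pairEquiv hxy).injective (hx _ h)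
        rw [e]
      · by_cases hb : b = Sum.inr false
        · rw [hb] at h ⊢
          exact (ha ((pairEquiv hxy).injective (hx _ (D.region.symm h)))).elim
        · refine s.trans (hκ a ha).1 (s.trans (le_glue _ _ _ (.inl ?_)) (s.symm (hκ b hb).1))
          exact D.region.trans (D.region.symm (hκ a ha).2) (D.region.trans h (hκ b hb).2)
  have hcard' : Nat.card (Quotient D₀.region) + 1 = Nat.card (Quotient D.region) := by
    have h₁ : Nat.card (Quotient s) = Nat.card (Quotient D.region) := by
      rw [hs]
      exact card_quotient_comap _ fun z =>
        ⟨(pairEquiv hxy).symm z, by rw [Equiv.apply_symm_apply]⟩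
    have h₂ : Nat.card (Quotient s) + 1 = _ :=
      card_quotient_glue (sumSetoid_inl_inr D₀.region ⊥ p₀ true)
    rw [card_quotient_sumSetoid, card_quotient_bot, Nat.card_eq_fintype_card (α := Bool),
      Fintype.card_bool] at h₂
    omega
  have hdiag : D₀.IsDiagram := by
    have : Nonempty {z // z ≠ x ∧ z ≠ y} := ⟨p₀⟩
    refine isDiagram_of_forall_not_isCrossing (fun z => not_not.2 (Subtype.ext (hrr z))) hee₀ hne₀
      hne₀ rfl (fun z => ?_) ?_ ?_
    · change D.region (D.rot (D.rot z)) z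
      rw [hrr]
    -- `ρ` need not preserve the region of `x`, but that region contains only `x`, which is
    -- therefore treated separately.
    · let ρ : α → {z // z ≠ x ∧ z ≠ y} := fun z => if h : z ≠ x ∧ z ≠ y then ⟨z, h⟩ else p₀
      have ρx : ρ x = p₀ := by simp [ρ]
      have ρy : ρ y = p₀ := by simp [ρ]
      have ρo : ∀ z (h : z ≠ x ∧ z ≠ y), ρ z = ⟨z, h⟩ := fun z h => dif_pos h
      have hrot : ∀ z, (D₀.conn.comap ρ) z (D.rot z) := by
        intro z
        rw [Setoid.comap_rel]
        by_cases h₁ : z = x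
        · rw [h₁, hrx, ρx, ρy]
        · by_cases h₂ : z = y
          · rw [h₂, hry, ρx, ρy]
          · rw [ρo z ⟨h₁, h₂⟩, ρo _ ((ne_and_ne_iff_of_involution hrr hrx z).2 ⟨h₁, h₂⟩)]
            exact D₀.conn_rot ⟨z, h₁, h₂⟩
      have hle : (⊤ : Setoid α) ≤ (D₀.region ⊔ D₀.conn).comap ρ := by
        rw [← hD.region_conn]
        have hρ : ∀ z, z ≠ x → D.region z (ρ z) := by
          intro z h₁
          by_cases h₂ : z = y
          · rw [h₂, ρy]
            exact hp
          · rw [ρo z ⟨h₁, h₂⟩]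
        refine sup_le (fun a b h => (le_sup_left : D₀.region ≤ D₀.region ⊔ D₀.conn) ?_)
          ((conn_le (fun z => her ▸ hrot z) hrot).trans
            fun a b h => (le_sup_right : D₀.conn ≤ D₀.region ⊔ D₀.conn) h)
        by_cases ha : a = x
        · rw [ha] at h
          rw [ha, hx b h]
        · by_cases hb : b = x
          · rw [hb] at h
            rw [hb, hx a (D.region.symm h)]
          · exact D.region.trans (D.region.symm (hρ a ha)) (D.region.trans h (hρ b hb))
      rw [eq_top_iff]
      intro a b _
      have := hle (x := (a : α)) (y := b) trivial
      rwa [Setoid.comap_rel, ρo a a.2, ρo b b.2] at this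
    · have := card_region_of_forall_not_isCrossing hD hc
      omega
  refine ⟨⟨D₀, hdiag, le_top⟩, p₀, pairEquiv hxy, fun z => not_not.2 (Subtype.ext (hrr z)), rfl,
    hcard, ?_⟩
  have hrot : ∀ z, D.rot (pairEquiv hxy z) =
      pairEquiv hxy (sumCongr D₀.rot boolNot z) := by
    rintro (z | _ | _)
    · rfl
    · exact hrx
    · exact hry
  constructor
  · rw [her]
    exact hrot
  · exact hrot
  · intro z
    rw [upper_eq_empty hD hc]
    simp [D₀, addTiedCircle, addCircle, removePair]
  · intro a b
    change _ ↔ s a b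
    rw [hs]
    rfl
  · intro a b
    rw [ht]
    refine iff_of_true trivial ?_
    change glue (sumSetoid ⊤ ⊤) (Sum.inl p₀) (Sum.inr true) a b
    rw [glue_rel_iff]
    rcases a with a | a <;> rcases b with b | b <;>
      simp [sumSetoid_inl_inl, sumSetoid_inr_inr, sumSetoid_inl_inr, sumSetoid_inr_inl, top_rel]

/-- A diagram consisting of one circle with one marked point. -/
theorem exists_isIso_circle (D : TiedDiagram α) (hc : ∀ x, ¬ D.IsCrossing x)
    (ht : D.tie = ⊤) (her : D.edge = D.rot) {x : α} (hx : ∀ z, D.region x z → z = x)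
    (hα : ∀ z, z = x ∨ z = D.rot x) :
    ∃ φ : Bool ≃ α, IsIso φ circleData D.toTiedData := by
  have hD := D.isDiagram
  have hrr : ∀ x, D.rot (D.rot x) = x := fun x => of_not_not (hc x)
  have hne := hD.rot_ne x
  have hbij : Function.Bijective (fun b : Bool => cond b x (D.rot x)) := by
    constructor
    · rintro (_ | _) (_ | _) h
      · rfl
      · exact (hne h).elim
      · exact (hne h.symm).elim
      · rfl
    · intro z
      rcases hα z with rfl | rfl
      · exact ⟨true, rfl⟩
      · exact ⟨false, rfl⟩
  have hrot : ∀ b, D.rot (Equiv.ofBijective _ hbij b) = Equiv.ofBijective _ hbij (boolNot b) := by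
    rintro (_ | _)
    · exact hrr x
    · rfl
  refine ⟨Equiv.ofBijective _ hbij, ⟨by rw [her]; exact hrot, hrot, fun b => ?_, ?_, fun a b => ?_⟩⟩
  · rw [upper_eq_empty hD hc]
    exact Iff.rfl
  · rintro (_ | _) (_ | _)
    · exact iff_of_true (D.region.refl _) rfl
    · exact iff_of_false (fun h => hne (hx _ (D.region.symm h))) Bool.false_ne_true
    · exact iff_of_false (fun h => hne (hx _ h)) Bool.false_ne_true.symm
    · exact iff_of_true (D.region.refl _) rfl
  · rw [ht]
    exact Iff.rfl

theorem C_delta : (C delta : (LaurentPolynomial ℤ)[X]) = -(varA ^ 2 + varAInv ^ 2) := by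
  rw [delta, varA, varAInv, ← C_pow, ← C_pow, ← C_add, ← C_neg, LaurentPolynomial.T_pow,
    LaurentPolynomial.T_pow]
  simp

/-- The value of a diagram without crossings whose components are all tied together. -/
theorem IsTiedBracket.eq_delta_pow {f : ∀ α : Type, TiedDiagram α → (LaurentPolynomial ℤ)[X]}
    (hf : IsTiedBracket f) {α : Type} (D : TiedDiagram α) (hc : ∀ x, ¬ D.IsCrossing x)
    (ht : D.tie = ⊤) : f α D = C (delta ^ (Nat.card (Quotient D.conn) - 1)) := by
  induction hn : Nat.card α using Nat.strong_induction_on generalizing α with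
  | _ n ih =>
    have hD := D.isDiagram
    have := hD.finite
    have := hD.nonempty
    have hcard : ∀ {a b : α} (hab : a ≠ b), Nat.card {x // x ≠ a ∧ x ≠ b} < n := by
      intro a b hab
      have h₃ := Nat.card_congr (pairEquiv hab)
      rw [Nat.card_sum, Nat.card_eq_fintype_card (α := Bool), Fintype.card_bool] at h₃
      omega
    -- Such a dart lies on a circle with several marked points, one of which can be erased.
    -- Otherwise every circle has just one.
    by_cases her : ∃ a, D.edge a ≠ D.rot a
    · obtain ⟨a, ha⟩ := her
      obtain ⟨D₀, p, φ, hc₀, ht₀, hcard₀, hφ⟩ := exists_isIso_mark D hc ht ha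
      have h₁ := hf.mark _ D₀ (hφ.symm.tiedDiagram) p rfl
      rw [hf.iso _ _ φ hφ.symm.tiedDiagram D hφ, h₁,
        ih _ (hcard (hD.rot_ne a).symm) D₀ hc₀ ht₀ rfl, hcard₀]
    · have her : D.edge = D.rot := Perm.ext (by simpa using her)
      have hconn := card_conn_of_edge_eq_rot her hD.edge_edge hD.edge_ne
      -- This is an innermost circle. If every region had two darts on its boundary, then `2R` would
      -- be at most the number `2C` of darts, contrary to `R = C + 1`.
      obtain ⟨x, hx⟩ : ∃ x, ∀ z, D.region x z → z = x := by
        by_contra! hcon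
        have h₁ : 2 * Nat.card (Quotient D.region) ≤ Nat.card α :=
          two_mul_card_quotient_le fun x => by
            obtain ⟨z, hz, hz'⟩ := hcon x
            exact ⟨z, hz', hz⟩
        have h₂ := card_region_of_forall_not_isCrossing hD hc
        omega
      by_cases hα : ∀ z, z = x ∨ z = D.rot x
      · obtain ⟨φ, hφ⟩ := exists_isIso_circle D hc ht her hx hα
        have h₁ := Nat.card_congr φ
        rw [Nat.card_eq_fintype_card (α := Bool), Fintype.card_bool] at h₁
        have h₂ : Nat.card (Quotient D.conn) - 1 = 0 := by omega
        rw [hf.iso _ _ φ hφ.symm.tiedDiagram D hφ, hf.circle _ rfl, h₂, pow_zero, C_1]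
      -- Some other circle borders the outer side of the innermost one. Otherwise its two darts
      -- would form a set closed under regions and connections, hence the whole diagram.
      · obtain ⟨p, hpx, hpy, hp⟩ : ∃ p, p ≠ x ∧ p ≠ D.rot x ∧ D.region (D.rot x) p := by
          by_contra! hcon
          have hrr : ∀ x, D.rot (D.rot x) = x := fun x => of_not_not (hc x)
          let t : Setoid α := Setoid.ker (fun z => z = x ∨ z = D.rot x)
          have hreg : ∀ a b, D.region a b → (a = x ∨ a = D.rot x) → (b = x ∨ b = D.rot x) := by
            rintro a b h (rfl | rfl)
            · exact .inl (hx b h)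
            · by_contra! hb
              exact hcon b hb.1 hb.2 h
          have hrot : ∀ z, t z (D.rot z) := fun z => propext (by
            change (z = x ∨ z = D.rot x) ↔ (D.rot z = x ∨ D.rot z = D.rot x)
            rw [D.rot.injective.eq_iff]
            constructor
            · rintro (rfl | rfl)
              · exact .inr rfl
              · exact .inl (hrr x)
            · rintro (h | rfl)
              · exact .inr (by rw [← h, hrr])
              · exact .inl rfl)
          have hle : (⊤ : Setoid α) ≤ t := by
            rw [← hD.region_conn]
            exact sup_le (fun a b h => propext ⟨hreg a b h, hreg b a (D.region.symm h)⟩)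
              (conn_le (fun z => her ▸ hrot z) hrot)
          refine hα fun z => ?_
          have : (x = x ∨ x = D.rot x) = (z = x ∨ z = D.rot x) := hle (x := x) (y := z) trivial
          exact this ▸ Or.inl rfl
        obtain ⟨D₀, p, φ, hc₀, ht₀, hcard₀, hφ⟩ :=
          exists_isIso_addTiedCircle D hc ht her hx hpx hpy hp
        have h₁ := hf.addTiedCircle _ D₀ (hφ.symm.tiedDiagram) p p rfl
        -- The exponents are truncated differences, so the remaining diagram must be known to have a
        -- circle.
        have h₂ : 0 < Nat.card (Quotient D₀.conn) := by
          have := D₀.isDiagram.finite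
          have := D₀.isDiagram.nonempty
          have : Nonempty (Quotient D₀.conn) := ‹Nonempty {z // _}›.map (Quotient.mk _)
          exact Nat.card_pos
        have h₃ : Nat.card (Quotient D.conn) - 1 = Nat.card (Quotient D₀.conn) - 1 + 1 := by omega
        rw [hf.iso _ _ φ hφ.symm.tiedDiagram D hφ, h₁,
          ih _ (hcard (hD.rot_ne x).symm) D₀ hc₀ ht₀ rfl, h₃, pow_succ' delta, C_mul,
          C_delta]

/-! ## The recursion for Kauffman's bracket -/

namespace LinkData

variable {α : Type} (D : LinkData α)

/-- The crossing at the vertex of a dart. -/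
def crossingAt {x : α} (hx : D.IsCrossing x) :
    D.Crossing :=
  ⟨Quotient.mk _ x, x, rfl, hx⟩

variable {D}

theorem crossingAt_eq_iff {x y : α}
    (hx : D.IsCrossing x) (hy : D.IsCrossing y) :
    D.crossingAt hx = D.crossingAt hy ↔ D.rot.SameCycle x y :=
  ⟨fun h => Quotient.exact (congrArg Subtype.val h), fun h => Subtype.ext (Quotient.sound h)⟩

theorem exists_crossingAt (c : D.Crossing) :
    ∃ (x : α) (hx : D.IsCrossing x), c = D.crossingAt hx := by
  obtain ⟨_, x, rfl, hx⟩ := c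
  exact ⟨x, hx, rfl⟩

end LinkData

/-! ### Crossings and states of a smoothing -/

namespace TiedData

open LinkData

variable {α : Type} {D : TiedData α} {u : α}

theorem sameCycle_of_smooth {x y : α} (h : (D.smooth u).rot.SameCycle x y) :
    D.rot.SameCycle x y := by
  have hle : Perm.SameCycle.setoid (D.smooth u).rot ≤ Perm.SameCycle.setoid D.rot := by
    refine sameCycle_le fun z => ?_
    change D.rot.SameCycle z _
    by_cases h₁ : z = u
    · rw [h₁, smooth_rot_self]
      exact ⟨3, rfl⟩
    · by_cases h₂ : z = D.rot (D.rot u)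
      · rw [h₂, smooth_rot_rot_rot]
        exact Perm.SameCycle.symm ⟨1, rfl⟩
      · rw [smooth_rot_of_ne h₁ h₂]
        exact ⟨1, rfl⟩
  exact hle h

theorem smooth_sameCycle (hD : D.IsDiagram) {x y : α} (hx : ¬ D.rot.SameCycle u x)
    (h : D.rot.SameCycle x y) : (D.smooth u).rot.SameCycle x y := by
  have h₁ := smooth_rot_of_not_sameCycle hx
  have h₂ := smooth_rot_of_not_sameCycle (not_sameCycle_rot hx)
  have h₃ := smooth_rot_of_not_sameCycle (not_sameCycle_rot (not_sameCycle_rot hx))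
  rcases (sameCycle_order_four hD.rot_four).1 h with rfl | rfl | rfl | rfl
  · exact Perm.SameCycle.refl _ _
  · exact ⟨1, h₁⟩
  · exact ⟨2, by simp [pow_two, h₁, h₂]⟩
  · exact ⟨3, by simp [pow_succ, h₁, h₂, h₃]⟩

/-- The crossing of a diagram corresponding to a crossing of its smoothing. -/
noncomputable def smoothCrossing (hD : D.IsDiagram) (hu : D.IsCrossing u)
    (c : (D.smooth u).Crossing) :
    D.Crossing :=
  ⟨Quotient.map' (s₁ := Perm.SameCycle.setoid (D.smooth u).rot)
      (s₂ := Perm.SameCycle.setoid D.rot) id (fun _ _ => sameCycle_of_smooth) c.1, by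
    obtain ⟨_, x, rfl, hx⟩ := c
    exact ⟨x, rfl, ((smooth_isCrossing hD hu).1 hx).1⟩⟩

theorem smoothCrossing_crossingAt (hD : D.IsDiagram) (hu : D.IsCrossing u) {x : α}
    (hx : (D.smooth u).IsCrossing x) :
    smoothCrossing hD hu ((D.smooth u).crossingAt hx) =
      D.crossingAt ((smooth_isCrossing hD hu).1 hx).1 := rfl

/-- The crossings of a smoothing are the other crossings of the diagram. -/
noncomputable def smoothCrossingEquiv (hD : D.IsDiagram) (hu : D.IsCrossing u) :
    (D.smooth u).Crossing ≃ {c : D.Crossing // c ≠ D.crossingAt hu} :=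
  Equiv.ofBijective (fun c => ⟨smoothCrossing hD hu c, by
    obtain ⟨x, hx, rfl⟩ := exists_crossingAt c
    rw [smoothCrossing_crossingAt, ne_eq, crossingAt_eq_iff]
    exact fun h => ((smooth_isCrossing hD hu).1 hx).2 h.symm⟩) (by
    constructor
    · intro c d h
      obtain ⟨x, hx, rfl⟩ := exists_crossingAt c
      obtain ⟨y, hy, rfl⟩ := exists_crossingAt d
      have h' := congrArg Subtype.val h
      simp only [smoothCrossing_crossingAt, crossingAt_eq_iff] at h'
      rw [crossingAt_eq_iff]
      exact smooth_sameCycle hD ((smooth_isCrossing hD hu).1 hx).2 h'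
    · rintro ⟨c, hc⟩
      obtain ⟨x, hx, rfl⟩ := exists_crossingAt c
      rw [ne_eq, crossingAt_eq_iff] at hc
      exact ⟨(D.smooth u).crossingAt ((smooth_isCrossing hD hu).2 ⟨hx, fun h => hc h.symm⟩), rfl⟩)

/-- By `hs`, the state chooses at the crossing of `u` the smoothing named by `u`. Over and under
alternate around a crossing, so `u` and `rot² u` turn back by `rot⁻¹` and the other two darts
advance by `rot`; these are the two marked points of the smoothing. -/
theorem statePartner_smooth (hD : D.IsDiagram) (hu : D.IsCrossing u) (s : D.Crossing → Bool)
    (hs : u ∈ D.upper ↔ s (D.crossingAt hu) = true) (x : α) :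
    (D.smooth u).statePartner (fun c => s (smoothCrossing hD hu c)) x = D.statePartner s x := by
  classical
  by_cases hx : D.IsCrossing x
  · by_cases hux : D.rot.SameCycle u x
    · have h₁ : ¬ (D.smooth u).IsCrossing x := fun h => ((smooth_isCrossing hD hu).1 h).2 hux
      have h₂ : D.crossingAt hx = D.crossingAt hu := (crossingAt_eq_iff hx hu).2 hux.symm
      have hup := hD.upper_rot
      rw [statePartner, dif_neg h₁, statePartner, dif_pos hx]
      change _ = if x ∈ D.upper ↔ s (D.crossingAt hx) = true then _ else _
      have key : (x ∈ D.upper ↔ s (D.crossingAt hx) = true) ↔ (x ∈ D.upper ↔ u ∈ D.upper) := by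
        rw [h₂, hs]
      have hr := hup u hu
      have hrr := hup _ ((isCrossing_rot u).2 hu)
      have hrrr := hup _ ((isCrossing_rot _).2 ((isCrossing_rot u).2 hu))
      rcases (sameCycle_order_four hD.rot_four).1 hux with rfl | rfl | rfl | rfl
      · rw [if_pos (key.2 Iff.rfl), smooth_rot_self, Equiv.eq_symm_apply, hD.rot_four]
      · rw [if_neg (fun h => absurd (key.1 h) (by tauto)), smooth_rot_rot hD]
      · rw [if_pos (key.2 (by tauto)), smooth_rot_rot_rot, Equiv.symm_apply_apply]
      · rw [if_neg (fun h => absurd (key.1 h) (by tauto)), smooth_rot_rot_rot_rot hD, hD.rot_four]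
    · have h₁ : (D.smooth u).IsCrossing x := (smooth_isCrossing hD hu).2 ⟨hx, hux⟩
      have h₂ : x ∈ (D.smooth u).upper ↔ x ∈ D.upper := and_iff_left hux
      have h₃ : (D.smooth u).rot.symm x = D.rot.symm x := by
        rw [Equiv.symm_apply_eq, smooth_rot_of_not_sameCycle, Equiv.apply_symm_apply]
        exact fun h => hux (by simpa using Perm.sameCycle_apply_right.2 h)
      rw [statePartner, dif_pos h₁, statePartner, dif_pos hx, h₂, h₃,
        smooth_rot_of_not_sameCycle hux]
      rfl
  · have h₁ : ¬ (D.smooth u).IsCrossing x := fun h => hx ((smooth_isCrossing hD hu).1 h).1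
    have hux : ¬ D.rot.SameCycle u x := fun h => hx ((isCrossing_of_sameCycle hD h).2 hu)
    rw [statePartner, dif_neg h₁, statePartner, dif_neg hx, smooth_rot_of_not_sameCycle hux]

theorem loops_smooth (hD : D.IsDiagram) (hu : D.IsCrossing u) (s : D.Crossing → Bool)
    (hs : u ∈ D.upper ↔ s (D.crossingAt hu) = true) :
    (D.smooth u).loops (fun c => s (smoothCrossing hD hu c)) = D.loops s := by
  unfold loops
  simp only [statePartner_smooth hD hu s hs]
  rfl

end TiedData

open TiedData LinkData

/-- The factor of a smoothing in Kauffman's bracket. -/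
noncomputable def smoothingWeight (b : Bool) : LaurentPolynomial ℤ :=
  if b = true then LaurentPolynomial.T 1 else LaurentPolynomial.T (-1)

/-- As a product over the crossings, the weight of a state lets the factor of a single crossing be
taken out. -/
theorem T_card_sub_card {ι : Type} [Fintype ι] (s : ι → Bool) :
    (LaurentPolynomial.T
      ((Nat.card {v // s v = true} : ℤ) - (Nat.card {v // s v = false} : ℤ)) :
        LaurentPolynomial ℤ) = ∏ v, smoothingWeight (s v) := by
  simp only [smoothingWeight]
  rw [Finset.prod_ite, Finset.prod_const, Finset.prod_const, LaurentPolynomial.T_pow,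
    LaurentPolynomial.T_pow, ← LaurentPolynomial.T_add, Nat.card_eq_fintype_card,
    Nat.card_eq_fintype_card, Fintype.card_subtype, Fintype.card_subtype]
  simp [sub_eq_add_neg]

namespace LinkData

variable {α : Type}

theorem finite_crossing [Finite α] (D : LinkData α) : Finite D.Crossing := by
  unfold Crossing
  infer_instance

/-- The contribution of a state to Kauffman's bracket. -/
noncomputable def stateTerm (D : LinkData α) [Fintype D.Crossing] (s : D.Crossing → Bool) :
    LaurentPolynomial ℤ :=
  (∏ v, smoothingWeight (s v)) * delta ^ (D.loops s - 1)

end LinkData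

open Classical in
theorem LinkDiagram.kauffmanBracket_eq_sum {α : Type} (L : LinkDiagram α) [Fintype L.Crossing] :
    L.kauffmanBracket = ∑ s : L.Crossing → Bool, L.stateTerm s := by
  rw [LinkDiagram.kauffmanBracket, finsum_eq_sum_of_fintype]
  simp only [T_card_sub_card, stateTerm]

-- States with value `b` at the crossing of `u` restrict bijectively to states of the smoothing. The
-- closed curves agree, and only the weight of the removed crossing is lost.
open Classical in
theorem sum_stateTerm_smooth {α : Type} {D : TiedData α} {u : α} (hD : D.IsDiagram)
    (hu : D.IsCrossing u) [Fintype D.Crossing] [Fintype (D.smooth u).Crossing] (b : Bool)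
    (hb : u ∈ D.upper ↔ b = true) :
    ∑ t : {c : D.Crossing // c ≠ D.crossingAt hu} → Bool,
        D.stateTerm ((Equiv.funSplitAt (D.crossingAt hu) Bool).symm (b, t)) =
      smoothingWeight b * ∑ s : (D.smooth u).Crossing → Bool, (D.smooth u).stateTerm s := by
  rw [Finset.mul_sum]
  refine Fintype.sum_equiv (Equiv.arrowCongr (smoothCrossingEquiv hD hu).symm (Equiv.refl Bool))
    _ _ fun t => ?_
  let s := (Equiv.funSplitAt (D.crossingAt hu) Bool).symm (b, t)
  have hsb : s (D.crossingAt hu) = b := by simp [s, Equiv.funSplitAt, Equiv.piSplitAt]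
  have hst : ∀ c : {c : D.Crossing // c ≠ D.crossingAt hu}, s c = t c := fun c => by
    simp [s, Equiv.funSplitAt, Equiv.piSplitAt, c.2]
  have ht : Equiv.arrowCongr (smoothCrossingEquiv hD hu).symm (Equiv.refl Bool) t =
      fun c => s (smoothCrossing hD hu c) := by
    funext c
    exact (hst (smoothCrossingEquiv hD hu c)).symm
  rw [ht]
  change D.stateTerm s = _
  rw [stateTerm, stateTerm, loops_smooth hD hu s (by rw [hsb]; exact hb), ← mul_assoc,
    Fintype.prod_eq_mul_prod_subtype_ne _ (D.crossingAt hu), hsb]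
  congr 2
  exact (Fintype.prod_equiv (smoothCrossingEquiv hD hu) _ _ fun c => rfl).symm

/-- The states are sorted by their value at the crossing of `u`. The over dart `u` names the
`A`-smoothing, and the under dart `rot u` the `B`-smoothing. -/
theorem LinkDiagram.kauffmanBracket_smooth {α : Type} (L L₁ L₂ : LinkDiagram α) {u : α}
    (hu : L.IsCrossing u) (hup : u ∈ L.upper)
    (h₁ : L₁.toLinkData = (L.allTied.smooth u).toLinkData)
    (h₂ : L₂.toLinkData = (L.allTied.smooth (L.rot u)).toLinkData) :
    L.kauffmanBracket = LaurentPolynomial.T 1 * L₁.kauffmanBracket +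
      LaurentPolynomial.T (-1) * L₂.kauffmanBracket := by
  classical
  have := L.isDiagram.finite
  have hu' : L.IsCrossing (L.rot u) := (isCrossing_rot u).2 hu
  have hup' : L.rot u ∉ L.upper := fun h => (L.isDiagram.upper_rot u hu).1 h hup
  have := finite_crossing L.toLinkData
  have := finite_crossing (L.allTied.smooth u).toLinkData
  have := finite_crossing (L.allTied.smooth (L.rot u)).toLinkData
  have := Fintype.ofFinite L.Crossing
  have := Fintype.ofFinite (L.allTied.smooth u).Crossing
  have := Fintype.ofFinite (L.allTied.smooth (L.rot u)).Crossing
  obtain ⟨L₁, i₁⟩ := L₁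
  obtain ⟨L₂, i₂⟩ := L₂
  dsimp only at h₁ h₂
  subst h₁ h₂
  have e₁ := @sum_stateTerm_smooth α L.allTied.toTiedData u L.isDiagram hu ‹Fintype L.Crossing› _
    true (iff_of_true hup rfl)
  have e₂ := @sum_stateTerm_smooth α L.allTied.toTiedData (L.rot u) L.isDiagram hu'
    ‹Fintype L.Crossing› _ false (iff_of_false hup' Bool.false_ne_true)
  have e : L.crossingAt hu' = L.crossingAt hu :=
    (crossingAt_eq_iff hu' hu).2 (Perm.SameCycle.symm ⟨1, rfl⟩)
  rw [LinkDiagram.kauffmanBracket_eq_sum, LinkDiagram.kauffmanBracket_eq_sum,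
    LinkDiagram.kauffmanBracket_eq_sum,
    ← (Equiv.funSplitAt (L.crossingAt hu) Bool).symm.sum_comp, Fintype.sum_prod_type,
    Fintype.sum_bool]
  have e' : L.allTied.crossingAt hu' = L.crossingAt hu := e
  rw [e'] at e₂
  exact congrArg₂ (· + ·) e₁ e₂

/-- There is only the empty state. With `rot` as partner map, its closed curves are the connected
components. -/
theorem LinkDiagram.kauffmanBracket_of_forall_not_isCrossing {α : Type} (L : LinkDiagram α)
    (hc : ∀ x, ¬ L.IsCrossing x) :
    L.kauffmanBracket = delta ^ (Nat.card (Quotient L.conn) - 1) := by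
  classical
  have : IsEmpty L.Crossing := ⟨fun c => by
    obtain ⟨x, hx, -⟩ := exists_crossingAt c
    exact hc x hx⟩
  have hl : ∀ s, L.loops s = Nat.card (Quotient L.conn) := fun s => by
    unfold loops conn
    simp only [statePartner, hc, dite_false]
  have : Fintype L.Crossing := Fintype.ofIsEmpty
  rw [LinkDiagram.kauffmanBracket_eq_sum]
  simp [stateTerm, hl]

/-- The bracket of a link diagram with all components tied together is Kauffman's bracket. -/
theorem IsTiedBracket.allTied {f : ∀ α : Type, TiedDiagram α → (LaurentPolynomial ℤ)[X]}
    (hf : IsTiedBracket f) {α : Type} (L : LinkDiagram α) :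
    f α L.allTied = C L.kauffmanBracket := by
  -- The induction counts darts at crossings, because smoothing keeps the set of darts and only
  -- turns the crossing into marked points.
  induction hn : Set.ncard {x | L.IsCrossing x} using Nat.strong_induction_on generalizing L with
  | _ n ih =>
    have := L.isDiagram.finite
    by_cases hc : ∀ x, ¬ L.IsCrossing x
    · rw [L.kauffmanBracket_of_forall_not_isCrossing hc]
      exact hf.eq_delta_pow _ hc rfl
    · push Not at hc
      obtain ⟨x, hx⟩ := hc
      obtain ⟨u, hu, hup⟩ := exists_upper L.isDiagram hx
      have hu' : L.IsCrossing (L.rot u) := (isCrossing_rot u).2 hu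
      have hsm : ∀ (v : α) (hv : L.IsCrossing v), ∃ L' : LinkDiagram α,
          L'.toLinkData = (L.allTied.smooth v).toLinkData ∧
          L'.allTied.toTiedData = L.allTied.smooth v ∧
          f α L'.allTied = C L'.kauffmanBracket := by
        intro v hv
        let L' : LinkDiagram α := ⟨(L.allTied.smooth v).toLinkData,
          smooth_isDiagram (D := L.allTied.toTiedData) L.isDiagram hv⟩
        refine ⟨L', rfl, TiedData.ext rfl rfl rfl rfl ?_, ih _ ?_ L' rfl⟩
        · exact (glue_eq_self trivial).symm
        · rw [← hn]
          refine Set.ncard_lt_ncard (Set.ssubset_iff_exists.2 ⟨fun y hy => ?_, v, hv, fun h => ?_⟩)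
            (Set.toFinite _)
          · exact ((smooth_isCrossing (D := L.allTied.toTiedData) L.isDiagram hv).1 hy).1
          · exact ((smooth_isCrossing (D := L.allTied.toTiedData) L.isDiagram hv).1 h).2
              (Perm.SameCycle.refl _ _)
      obtain ⟨L₁, h₁, k₁, e₁⟩ := hsm u hu
      obtain ⟨L₂, h₂, k₂, e₂⟩ := hsm (L.rot u) hu'
      rw [hf.skein_tied _ L.allTied L₁.allTied L₂.allTied u hu hup trivial k₁ k₂, e₁, e₂,
        L.kauffmanBracket_smooth L₁ L₂ hu hup h₁ h₂, varA, varAInv, C_add, C_mul, C_mul]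

end TiedLink

theorem mainTheorem10
    (f : ∀ α : Type, TiedLink.TiedDiagram α → (LaurentPolynomial ℤ)[X])
    (hf : TiedLink.IsTiedBracket f) :
    (∀ (α : Type) (D : TiedLink.TiedDiagram α) (p : α)
        (K : TiedLink.TiedDiagram (α ⊕ Bool)), ¬ D.IsCrossing p →
        K.toTiedData = D.curl true p → f _ K = -TiedLink.varA ^ 3 * f α D) ∧
    (∀ (α : Type) (D : TiedLink.TiedDiagram α) (p : α)
        (K : TiedLink.TiedDiagram (α ⊕ Bool)), ¬ D.IsCrossing p →
        K.toTiedData = D.curl false p → f _ K = -TiedLink.varAInv ^ 3 * f α D) ∧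
    (∀ (α : Type) (L : TiedLink.LinkDiagram α),
        f α L.allTied = C L.kauffmanBracket) ∧
    (∀ (α : Type) (L : TiedLink.LinkDiagram α), L.component = ⊤ →
        f α L.noTies = C L.kauffmanBracket) := by
  refine ⟨fun α D p K hp hK => hf.curl D p K hp true hK,
    fun α D p K hp hK => hf.curl D p K hp false hK, fun α L => hf.allTied L, fun α L hL => ?_⟩
  -- For a knot the partition into components is already the trivial one, so both tied diagrams
  -- coincide.
  have h : L.noTies = L.allTied := by
    simp only [TiedLink.LinkDiagram.noTies, TiedLink.LinkDiagram.allTied, hL]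
  rw [h, hf.allTied]
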